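/- Let $D=\{z\in\mathbb C:|z|<1\}$ and let $dA$ be Lebesgue area measure on $D$, normalized so that $D$ has measure $1$. Let $L^2_a$ be the Bergman space, that is, the closed subspace of $L^2(D,dA)$ consisting of the functions that are analytic on $D$, and let $P$ be the orthogonal projection of $L^2(D,dA)$ onto $L^2_a$. For $z\in D$ let $K_z\in L^2_a$ be the reproducing kernel, determined by $f(z)=\langle f,K_z\rangle$ for every $f\in L^2_a$, and let $k_z=K_z/\|K_z\|_2$. For $u\in L^\infty(D,dA)$ let $T_u\colon L^2_a\to L^2_a$, $T_uf=P(uf)$, be the Toeplitz operator with symbol $u$, and let \[ \tilde u(z)=\langle T_uk_z,k_z\rangle=\int_D u\,|k_z|^2\,dA\qquad(z\in D) \] be the Berezin transform of $u$. If $u\in L^\infty(D,dA)$, then $T_u$ is compact if and only if $\tilde u(z)\to 0$ as $z\to\partial D$ (that is, as $|z|\to 1$). -/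

import Mathlib

open MeasureTheory Metric Set Filter Topology Complex.UnitDisc
open scoped ENNReal

noncomputable section

/-- Lebesgue area measure on the open unit disk, normalized to have total mass `1`. -/
def diskMeasure : Measure ℂ :=
  (volume (ball (0 : ℂ) 1))⁻¹ • volume.restrict (ball (0 : ℂ) 1)

instance : IsProbabilityMeasure diskMeasure := by
  refine ⟨?_⟩
  simp only [diskMeasure, Measure.smul_apply, Measure.restrict_apply_univ, smul_eq_mul]
  exact ENNReal.inv_mul_cancel (measure_ball_pos volume _ one_pos).ne' measure_ball_lt_top.ne

/-- The Bergman space: the (classes of) functions in `L²(D, dA)` that are analytic on `D`. -/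
def bergmanSpace : Submodule ℂ (Lp ℂ 2 diskMeasure) where
  carrier := {f | ∃ g : ℂ → ℂ, DifferentiableOn ℂ g (ball 0 1) ∧ f =ᵐ[diskMeasure] g}
  add_mem' := by
    rintro a b ⟨g, hg, hag⟩ ⟨h, hh, hbh⟩
    exact ⟨g + h, hg.add hh, (Lp.coeFn_add a b).trans (hag.add hbh)⟩
  zero_mem' := ⟨0, differentiableOn_const 0, Lp.coeFn_zero _ _ _⟩
  smul_mem' := by
    rintro c a ⟨g, hg, hag⟩
    exact ⟨c • g, hg.const_smul c, (Lp.coeFn_smul c a).trans (hag.const_smul c)⟩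

lemma enorm_le_circle {g : ℂ → ℂ} (hg : DifferentiableOn ℂ g (ball 0 1)) {z w : ℂ}
    (hw : ‖w‖ < 1 - ‖z‖) :
    ENNReal.ofReal (2 * Real.pi) * ‖g z‖ₑ ≤
      ∫⁻ θ in Ioc 0 (2 * Real.pi), ‖g (z + circleMap 0 1 θ * w)‖ₑ := by
  have hd : DifferentiableOn ℂ (fun ζ => g (z + ζ * w)) (closedBall 0 1) := by
    refine hg.comp (by fun_prop) ?_
    intro ζ hζ
    rw [mem_closedBall_zero_iff] at hζ
    rw [mem_ball_zero_iff]
    calc ‖z + ζ * w‖ ≤ ‖z‖ + ‖ζ‖ * ‖w‖ := (norm_add_le _ _).trans (by rw [norm_mul])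
      _ < 1 := by nlinarith [norm_nonneg w]
  have h := DiffContOnCl.circleAverage (R := 1) (c := 0) (f := fun ζ => g (z + ζ * w))
    (by rw [abs_one]; exact hd.diffContOnCl_ball subset_rfl)
  rw [Real.circleAverage_def] at h
  have h2 : ((2 * Real.pi : ℝ) : ℂ) * g z
      = ∫ θ in 0..2 * Real.pi, g (z + circleMap 0 1 θ * w) := by
    rw [show g z = g (z + 0 * w) by simp, ← h, Complex.real_smul, ← mul_assoc]
    have : ((2 * Real.pi : ℝ) : ℂ) ≠ 0 := by exact_mod_cast Real.two_pi_pos.ne'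
    rw [Complex.ofReal_inv, mul_inv_cancel₀ this, one_mul]
  rw [intervalIntegral.integral_of_le Real.two_pi_pos.le] at h2
  calc _ = ‖((2 * Real.pi : ℝ) : ℂ) * g z‖ₑ := by
        rw [enorm_mul]; congr 1
        rw [← ofReal_norm, Complex.norm_real, Real.norm_of_nonneg Real.two_pi_pos.le]
    _ ≤ _ := by rw [h2]; exact enorm_integral_le_lintegral_enorm _

lemma enorm_le_area {g : ℂ → ℂ} (hg : DifferentiableOn ℂ g (ball 0 1)) (z : ℂ) :
    volume (ball (0 : ℂ) (1 - ‖z‖)) * ‖g z‖ₑ ≤ ∫⁻ w in ball 0 1, ‖g w‖ₑ := by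
  set s := 1 - ‖z‖
  set G : ℂ → ℝ≥0∞ := (ball 0 1).indicator fun w => ‖g w‖ₑ with hG
  have hGm : Measurable G := by
    have : Measurable ((ball (0 : ℂ) 1).indicator g) := by
      classical
      rw [← piecewise_eq_indicator]
      exact hg.continuousOn.measurable_piecewise continuousOn_const isOpen_ball.measurableSet
    convert this.enorm using 2 with w
    simp [hG, indicator]; split_ifs <;> simp
  have hpt : ∀ w ∈ ball (0 : ℂ) s, ENNReal.ofReal (2 * Real.pi) * ‖g z‖ₑ ≤
      ∫⁻ θ in Ioc 0 (2 * Real.pi), G (z + circleMap 0 1 θ * w) := by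
    intro w hw
    rw [mem_ball_zero_iff] at hw
    refine (enorm_le_circle hg hw).trans_eq (lintegral_congr fun θ => ?_)
    rw [hG, indicator_of_mem]
    rw [mem_ball_zero_iff]
    calc _ ≤ ‖z‖ + ‖circleMap 0 1 θ‖ * ‖w‖ := (norm_add_le _ _).trans (by rw [norm_mul])
      _ < 1 := by simp; linarith
  have hint : ∀ θ : ℝ, ∫⁻ w in ball (0 : ℂ) s, G (z + circleMap 0 1 θ * w)
      ≤ ∫⁻ w in ball 0 1, ‖g w‖ₑ := by
    intro θ
    refine (setLIntegral_le_lintegral _ _).trans_eq ?_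
    have hmp := (rotation (Circle.exp θ)).measurePreserving
    have h1 := hmp.lintegral_comp (f := fun w => G (z + w)) (by fun_prop)
    have : ∀ w, circleMap 0 1 θ * w = rotation (Circle.exp θ) w := by
      intro w; simp [circleMap]
    simp_rw [this]
    rw [h1, lintegral_add_left_eq_self, hG, lintegral_indicator isOpen_ball.measurableSet]
  have h2π : ENNReal.ofReal (2 * Real.pi) ≠ 0 := by simp [Real.pi_pos]
  refine (ENNReal.mul_le_mul_iff_right h2π ENNReal.ofReal_ne_top).1 ?_
  calc _ = ∫⁻ w in ball (0 : ℂ) s, ENNReal.ofReal (2 * Real.pi) * ‖g z‖ₑ := by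
        rw [setLIntegral_const]; ring
    _ ≤ ∫⁻ w in ball (0 : ℂ) s, ∫⁻ θ in Ioc 0 (2 * Real.pi), G (z + circleMap 0 1 θ * w) :=
        setLIntegral_mono' isOpen_ball.measurableSet hpt
    _ = ∫⁻ θ in Ioc 0 (2 * Real.pi), ∫⁻ w in ball (0 : ℂ) s, G (z + circleMap 0 1 θ * w) := by
        refine lintegral_lintegral_swap (Measurable.aemeasurable ?_)
        refine hGm.comp (Continuous.measurable ?_)
        have := continuous_circleMap 0 1
        fun_prop
    _ ≤ ∫⁻ θ in Ioc 0 (2 * Real.pi), ∫⁻ w in ball 0 1, ‖g w‖ₑ := lintegral_mono hint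
    _ = _ := by rw [setLIntegral_const, Real.volume_Ioc, sub_zero, mul_comm]

/-- Point evaluations are bounded on the Bergman space, locally uniformly in the point. -/
lemma norm_le_of_ae_eq {g : ℂ → ℂ} (hg : DifferentiableOn ℂ g (ball 0 1)) {z : ℂ}
    (hz : z ∈ ball (0 : ℂ) 1) {f : Lp ℂ 2 diskMeasure} (hf : f =ᵐ[diskMeasure] g) :
    ‖g z‖ ≤ ((1 - ‖z‖) ^ 2)⁻¹ * ‖f‖ := by
  rw [mem_ball_zero_iff] at hz
  have hs : 0 < 1 - ‖z‖ := by linarith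
  have hV0 : volume (ball (0 : ℂ) 1) ≠ 0 := (measure_ball_pos volume _ one_pos).ne'
  have hVt : volume (ball (0 : ℂ) 1) ≠ ∞ := measure_ball_lt_top.ne
  have h1 := enorm_le_area hg z
  have h2 : ∫⁻ w in ball 0 1, ‖g w‖ₑ ≤ volume (ball (0 : ℂ) 1) * ‖f‖ₑ := by
    have e1 : eLpNorm g 1 diskMeasure = (volume (ball (0 : ℂ) 1))⁻¹ * ∫⁻ w in ball 0 1, ‖g w‖ₑ := by
      rw [eLpNorm_one_eq_lintegral_enorm, diskMeasure, lintegral_smul_measure, smul_eq_mul]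
    have e2 : eLpNorm g 1 diskMeasure ≤ ‖f‖ₑ := by
      rw [Lp.enorm_def, ← eLpNorm_congr_ae hf]
      exact eLpNorm_le_eLpNorm_of_exponent_le one_le_two (Lp.aestronglyMeasurable f)
    rw [e1] at e2
    calc _ = volume (ball (0 : ℂ) 1) * ((volume (ball (0 : ℂ) 1))⁻¹ *
            ∫⁻ w in ball 0 1, ‖g w‖ₑ) := by
          rw [← mul_assoc, ENNReal.mul_inv_cancel hV0 hVt, one_mul]
      _ ≤ _ := by gcongr
  rw [Measure.addHaar_ball _ _ hs.le, Complex.finrank_real_complex] at h1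
  have h3 : ENNReal.ofReal ((1 - ‖z‖) ^ 2) * ‖g z‖ₑ ≤ ‖f‖ₑ := by
    refine (ENNReal.mul_le_mul_iff_right hV0 hVt).1 ((le_of_eq (by ring)).trans (h1.trans h2))
  rw [← ofReal_norm, ← ofReal_norm, ← ENNReal.ofReal_mul (by positivity),
    ENNReal.ofReal_le_ofReal_iff (norm_nonneg _)] at h3
  rwa [inv_mul_eq_div, le_div_iff₀' (by positivity)]

namespace bergmanSpace

/-- The analytic function on `D` representing an element of the Bergman space
(its values outside `D` are irrelevant). -/
def rep (f : bergmanSpace) : ℂ → ℂ := f.2.choose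

lemma differentiableOn_rep (f : bergmanSpace) : DifferentiableOn ℂ (rep f) (ball 0 1) :=
  f.2.choose_spec.1

lemma coe_ae_eq_rep (f : bergmanSpace) : (f : Lp ℂ 2 diskMeasure) =ᵐ[diskMeasure] rep f :=
  f.2.choose_spec.2

lemma rep_eqOn {f : bergmanSpace} {g : ℂ → ℂ} (hg : DifferentiableOn ℂ g (ball 0 1))
    (h : (f : Lp ℂ 2 diskMeasure) =ᵐ[diskMeasure] g) : EqOn (rep f) g (ball 0 1) := by
  intro z hz
  have h0 : ((0 : Lp ℂ 2 diskMeasure) : ℂ → ℂ) =ᵐ[diskMeasure] rep f - g := by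
    filter_upwards [coe_ae_eq_rep f, h, Lp.coeFn_zero ℂ 2 diskMeasure] with w h1 h2 h3
    simp [← h1, ← h2]
  have := norm_le_of_ae_eq ((differentiableOn_rep f).sub hg) hz h0
  rw [norm_zero, mul_zero] at this
  exact sub_eq_zero.1 (norm_le_zero_iff.1 this)

lemma rep_add (f g : bergmanSpace) : EqOn (rep (f + g)) (rep f + rep g) (ball 0 1) :=
  rep_eqOn ((differentiableOn_rep f).add (differentiableOn_rep g))
    ((Lp.coeFn_add _ _).trans ((coe_ae_eq_rep f).add (coe_ae_eq_rep g)))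

lemma rep_smul (c : ℂ) (f : bergmanSpace) : EqOn (rep (c • f)) (c • rep f) (ball 0 1) :=
  rep_eqOn ((differentiableOn_rep f).const_smul c)
    ((Lp.coeFn_smul _ _).trans ((coe_ae_eq_rep f).const_smul c))

lemma rep_sub (f g : bergmanSpace) : EqOn (rep (f - g)) (rep f - rep g) (ball 0 1) :=
  rep_eqOn ((differentiableOn_rep f).sub (differentiableOn_rep g))
    ((Lp.coeFn_sub _ _).trans ((coe_ae_eq_rep f).sub (coe_ae_eq_rep g)))

lemma norm_rep_le (f : bergmanSpace) {z : ℂ} (hz : z ∈ ball (0 : ℂ) 1) :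
    ‖rep f z‖ ≤ ((1 - ‖z‖) ^ 2)⁻¹ * ‖f‖ :=
  norm_le_of_ae_eq (differentiableOn_rep f) hz (coe_ae_eq_rep f)

/-- Evaluation at the points of `D`, which makes the Bergman space a reproducing kernel
Hilbert space of functions on `D`. -/
instance : RKHS ℂ bergmanSpace 𝔻 ℂ where
  coeCLM := ContinuousLinearMap.pi fun z =>
    LinearMap.mkContinuous
      { toFun := fun f => rep f z
        map_add' := fun f g => rep_add f g (mem_ball_zero_iff.2 z.norm_lt_one)
        map_smul' := fun c f => rep_smul c f (mem_ball_zero_iff.2 z.norm_lt_one) }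
      ((1 - ‖(z : ℂ)‖) ^ 2)⁻¹ fun f => norm_rep_le f (mem_ball_zero_iff.2 z.norm_lt_one)
  coeCLM_injective := by
    intro f g h
    have h' : ∀ w ∈ ball (0 : ℂ) 1, rep f w = rep g w := fun w hw =>
      congrFun h (Complex.UnitDisc.mk w (mem_ball_zero_iff.1 hw))
    refine Subtype.ext (Lp.ext ?_)
    have hae : ∀ᵐ w ∂diskMeasure, w ∈ ball (0 : ℂ) 1 :=
      Measure.ae_smul_measure (ae_restrict_mem isOpen_ball.measurableSet) _
    filter_upwards [coe_ae_eq_rep f, coe_ae_eq_rep g, hae] with w h1 h2 h3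
    rw [h1, h2, h' w h3]

/-- The value at `z` of an element of the Bergman space is the value of the analytic function
that represents it. -/
lemma apply_eq {f : bergmanSpace} {g : ℂ → ℂ} (hg : DifferentiableOn ℂ g (ball 0 1))
    (h : (f : Lp ℂ 2 diskMeasure) =ᵐ[diskMeasure] g) (z : 𝔻) : f z = g z :=
  rep_eqOn hg h (mem_ball_zero_iff.2 z.norm_lt_one)

lemma isClosed : IsClosed (bergmanSpace : Set (Lp ℂ 2 diskMeasure)) := by
  refine isSeqClosed_iff_isClosed.1 ?_
  intro F f hF hlim
  let B : ℕ → bergmanSpace := fun n => ⟨F n, hF n⟩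
  have hC : CauchySeq B := by
    have := hlim.cauchySeq
    rwa [Metric.cauchySeq_iff] at this ⊢
  -- pointwise limit of the representatives
  have hdist : ∀ (m n : ℕ) (z : ℂ), z ∈ ball (0 : ℂ) 1 →
      dist (rep (B m) z) (rep (B n) z) ≤ ((1 - ‖z‖) ^ 2)⁻¹ * dist (B m) (B n) := by
    intro m n z hz
    rw [dist_eq_norm, dist_eq_norm]
    have := norm_rep_le (B m - B n) hz
    rwa [rep_sub _ _ hz] at this
  have hUC : ∀ K ⊆ ball (0 : ℂ) 1, IsCompact K →
      UniformCauchySeqOn (fun n => rep (B n)) atTop K := by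
    intro K hK hKc
    obtain ⟨C, hCb⟩ : ∃ C, ∀ z ∈ K, ((1 - ‖z‖) ^ 2)⁻¹ ≤ C := by
      have hcont : ContinuousOn (fun z : ℂ => ((1 - ‖z‖) ^ 2)⁻¹) K := by
        refine ContinuousOn.inv₀ (by fun_prop) fun z hz => ?_
        have := mem_ball_zero_iff.1 (hK hz)
        exact pow_ne_zero _ (by linarith)
      obtain ⟨C, hC⟩ := (hKc.bddAbove_image hcont)
      exact ⟨C, fun z hz => hC ⟨z, hz, rfl⟩⟩
    rw [Metric.uniformCauchySeqOn_iff]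
    intro ε hε
    have hpos : 0 < |C| + 1 := by positivity
    obtain ⟨N, hN⟩ := Metric.cauchySeq_iff.1 hC (ε / (|C| + 1)) (by positivity)
    refine ⟨N, fun m hm n hn z hz => (hdist m n z (hK hz)).trans_lt ?_⟩
    have h1 := hN m hm n hn
    rw [lt_div_iff₀ hpos] at h1
    have h2 : ((1 - ‖z‖) ^ 2)⁻¹ ≤ |C| + 1 := by
      linarith [hCb z hz, le_abs_self C]
    nlinarith [dist_nonneg (x := B m) (y := B n)]
  have hpt : ∀ z : ℂ, ∃ l, z ∈ ball (0 : ℂ) 1 → Tendsto (fun n => rep (B n) z) atTop (𝓝 l) := by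
    intro z
    by_cases hz : z ∈ ball (0 : ℂ) 1
    · obtain ⟨l, hl⟩ := cauchySeq_tendsto_of_complete
        ((hUC {z} (singleton_subset_iff.2 hz) isCompact_singleton).cauchySeq rfl)
      exact ⟨l, fun _ => hl⟩
    · exact ⟨0, fun h => absurd h hz⟩
  choose G hG using hpt
  have hGd : DifferentiableOn ℂ G (ball 0 1) := by
    refine TendstoLocallyUniformlyOn.differentiableOn (F := fun n => rep (B n)) (φ := atTop) ?_
      (Eventually.of_forall fun n => differentiableOn_rep (B n)) isOpen_ball
    rw [tendstoLocallyUniformlyOn_iff_forall_isCompact isOpen_ball]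
    intro K hK hKc
    exact (hUC K hK hKc).tendstoUniformlyOn_of_tendsto fun z hz => hG z (hK hz)
  refine ⟨G, hGd, ?_⟩
  obtain ⟨ns, hns, hae⟩ := (tendstoInMeasure_of_tendsto_Lp hlim).exists_seq_tendsto_ae
  have hD : ∀ᵐ w ∂diskMeasure, w ∈ ball (0 : ℂ) 1 :=
    Measure.ae_smul_measure (ae_restrict_mem isOpen_ball.measurableSet) _
  have hall : ∀ᵐ w ∂diskMeasure, ∀ n, F n w = rep (B n) w :=
    ae_all_iff.2 fun n => coe_ae_eq_rep (B n)
  filter_upwards [hae, hD, hall] with w h1 h2 h3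
  refine tendsto_nhds_unique h1 ?_
  simp_rw [h3]
  exact (hG w h2).comp hns.tendsto_atTop

instance : CompleteSpace bergmanSpace := isClosed.completeSpace_coe

end bergmanSpace

/-- The Bergman reproducing kernel `K_z`. -/
def bergmanKernel (z : 𝔻) : bergmanSpace := RKHS.kerFun bergmanSpace z 1

/-- The defining property `f(z) = ⟨f, K_z⟩` of the kernel (in Mathlib the inner product is
conjugate-linear in its first argument). -/
lemma inner_bergmanKernel (z : 𝔻) (f : bergmanSpace) : inner ℂ (bergmanKernel z) f = f z := by
  simp [bergmanKernel, RKHS.kerFun_inner]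

/-- The normalized Bergman reproducing kernel `k_z = K_z / ‖K_z‖₂`. -/
def normalizedKernel (z : 𝔻) : bergmanSpace :=
  ((‖bergmanKernel z‖ : ℂ))⁻¹ • bergmanKernel z

/-- Multiplication by `u ∈ L^∞(D, dA)` as a bounded operator on `L²(D, dA)`. -/
def mulOp (u : Lp ℂ ∞ diskMeasure) : Lp ℂ 2 diskMeasure →L[ℂ] Lp ℂ 2 diskMeasure :=
  (ContinuousLinearMap.mul ℂ ℂ).holderL diskMeasure ∞ 2 2 u

/-- The Toeplitz operator `T_u f = P(u f)` on the Bergman space, where `P` is the orthogonal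
projection of `L²(D, dA)` onto the Bergman space. -/
def toeplitz (u : Lp ℂ ∞ diskMeasure) : bergmanSpace →L[ℂ] bergmanSpace :=
  bergmanSpace.orthogonalProjectionOnto ∘L mulOp u ∘L bergmanSpace.subtypeL

/-- The Berezin transform `S̃(z) = ⟨S k_z, k_z⟩` of a bounded operator on the Bergman space. -/
def berezin (S : bergmanSpace →L[ℂ] bergmanSpace) (z : 𝔻) : ℂ :=
  inner ℂ (normalizedKernel z) (S (normalizedKernel z))

/-- The Berezin transform of a bounded function `u`, that is, of its Toeplitz operator. -/
def berezinSymbol (u : Lp ℂ ∞ diskMeasure) (z : 𝔻) : ℂ :=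
  berezin (toeplitz u) z

/-- The Berezin transform of `u` as an integral: `ũ(z) = ∫ u |k_z|² dA`. -/
lemma berezinSymbol_eq_integral (u : Lp ℂ ∞ diskMeasure) (z : 𝔻) :
    berezinSymbol u z =
      ∫ w, u w * (‖(normalizedKernel z : Lp ℂ 2 diskMeasure) w‖ ^ 2 : ℝ) ∂diskMeasure := by
  simp only [berezinSymbol, berezin, toeplitz, ContinuousLinearMap.comp_apply]
  rw [Submodule.inner_orthogonalProjectionOnto_eq_of_mem_left, L2.inner_def]
  refine integral_congr_ae ?_
  filter_upwards [(ContinuousLinearMap.mul ℂ ℂ).coeFn_holder (r := 2) u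
    (normalizedKernel z : Lp ℂ 2 diskMeasure)] with w hw
  rw [show mulOp u (bergmanSpace.subtypeL (normalizedKernel z)) =
    (ContinuousLinearMap.mul ℂ ℂ).holder 2 u (normalizedKernel z : Lp ℂ 2 diskMeasure) from rfl, hw]
  simp only [RCLike.inner_apply, ContinuousLinearMap.mul_apply']
  rw [mul_assoc, Complex.mul_conj, Complex.normSq_eq_norm_sq]

/-- The filter on `D` of the approach to the boundary, `|z| → 1`. -/
def toBoundary : Filter 𝔻 := comap (fun z : 𝔻 => ‖(z : ℂ)‖) (𝓝 1)
end

/-! A compact operator turns weak convergence into norm convergence, and the unit vectors `k_z` tend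
weakly to 0 at the boundary (`tendsto_inner_normalizedKernel`); hence the Berezin transform of a
compact operator vanishes there.

For the converse, let φ_z be the Möbius involution exchanging 0 and z. The Berezin transform is
conformally invariant: its value for u at φ_z(a) is its value for u ∘ φ_z at a
(`berezinSymbol_moebiusDisc`). So the hypothesis says that, for each fixed a, the integral of u ∘
φ_z against |K_a|² tends to 0 as |z| → 1. Linear combinations of the |K_a|² approximate every power
of η̄ uniformly on D (`exists_kernelFun_approx_conj_pow`), and the powers approximate conj K_a; thus
T_{u∘φ_z} 1 → 0 pointwise. A bound by a multiple of (1 - |a|)^(-1/10), uniform in z, improves this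
to convergence in L⁶ (`tendsto_translateNorm`).

The operator T_u has integral kernel (T_u K_z)(w). The substitution w = φ_z(a) and Hölder's
inequality bound its Schur integral over w, with weight (1 - |w|²)^(-1/2), by C ‖T_{u∘φ_z} 1‖₆ times
the weight at z; the integral over z is bounded in the same way for the conjugate symbol.
Restricting the kernel to |z| > r therefore leaves an operator of small norm
(`enorm_toeplitz_sub_cutoff_sq_le`). The discarded part is T_u composed with the Toeplitz operator
of the indicator of a smaller disk, which is compact (`isCompactOperator_cutoff`). So T_u is a norm
limit of compact operators. -/

open scoped ComplexConjugate

noncomputable section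

/-! ### Möbius involutions of the disk -/

/-- The involutive automorphism of the unit disk exchanging `0` and `z`. -/
def moebius (z w : ℂ) : ℂ := (z - w) / (1 - conj z * w)

lemma one_sub_norm_le_norm_one_sub_mul {a b : ℂ} (ha : ‖a‖ ≤ 1) : 1 - ‖b‖ ≤ ‖1 - a * b‖ := by
  have h1 := norm_sub_norm_le (1 : ℂ) (a * b)
  rw [norm_one, norm_mul] at h1
  nlinarith [norm_nonneg b]

lemma one_sub_mul_ne_zero {a b : ℂ} (ha : ‖a‖ < 1) (hb : ‖b‖ < 1) : 1 - a * b ≠ 0 := by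
  have := one_sub_norm_le_norm_one_sub_mul (b := b) ha.le
  exact norm_pos_iff.1 (by linarith)

lemma one_sub_conj_mul_ne_zero {a b : ℂ} (ha : ‖a‖ < 1) (hb : ‖b‖ < 1) : 1 - conj a * b ≠ 0 :=
  one_sub_mul_ne_zero (by simpa using ha) hb

lemma one_sub_mul_conj_ne_zero {a b : ℂ} (ha : ‖a‖ < 1) (hb : ‖b‖ < 1) : 1 - a * conj b ≠ 0 :=
  one_sub_mul_ne_zero ha (by simpa using hb)

lemma one_sub_norm_sq_pos {z : ℂ} (hz : ‖z‖ < 1) : 0 < 1 - ‖z‖ ^ 2 := by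
  nlinarith [norm_nonneg z]

lemma one_sub_norm_sq_ne_zero {z : ℂ} (hz : ‖z‖ < 1) : (1 - (‖z‖ : ℂ) ^ 2) ≠ 0 := by
  exact_mod_cast (one_sub_norm_sq_pos hz).ne'

/-- The source of all Möbius identities below: a = b gives 1 - |φ_z(a)|², a = 0 gives 1 - z̄ φ_z(b),
and the inverse square is the transformation law of the Bergman kernel. -/
lemma one_sub_conj_moebius_mul_moebius {z a b : ℂ} (hz : ‖z‖ < 1) (ha : ‖a‖ < 1) (hb : ‖b‖ < 1) :
    1 - conj (moebius z a) * moebius z b =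
      (1 - (‖z‖ : ℂ) ^ 2) * (1 - conj a * b) / ((1 - z * conj a) * (1 - conj z * b)) := by
  have h1 := one_sub_mul_conj_ne_zero hz ha
  have h2 := one_sub_conj_mul_ne_zero hz hb
  rw [← Complex.mul_conj']
  simp only [moebius, map_div₀, map_sub, map_one, map_mul, Complex.conj_conj]
  rw [div_mul_div_comm, eq_div_iff (mul_ne_zero h1 h2), sub_mul,
    div_mul_cancel₀ _ (mul_ne_zero h1 h2)]
  ring

lemma one_sub_norm_moebius_sq {z a : ℂ} (hz : ‖z‖ < 1) (ha : ‖a‖ < 1) :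
    1 - ‖moebius z a‖ ^ 2 = (1 - ‖z‖ ^ 2) * (1 - ‖a‖ ^ 2) / ‖1 - conj z * a‖ ^ 2 := by
  have h := one_sub_conj_moebius_mul_moebius hz ha ha
  rw [Complex.conj_mul', Complex.conj_mul', show 1 - z * conj a = conj (1 - conj z * a) by simp,
    Complex.conj_mul'] at h
  exact_mod_cast h

lemma norm_moebius_lt_one {z a : ℂ} (hz : ‖z‖ < 1) (ha : ‖a‖ < 1) : ‖moebius z a‖ < 1 := by
  have h := one_sub_norm_moebius_sq hz ha
  have h2 := norm_pos_iff.2 (one_sub_conj_mul_ne_zero hz ha)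
  have h3 : 0 < 1 - ‖moebius z a‖ ^ 2 := by
    rw [h]
    have := one_sub_norm_sq_pos hz
    have := one_sub_norm_sq_pos ha
    positivity
  nlinarith [norm_nonneg (moebius z a)]

@[simp] lemma moebius_zero_right (z : ℂ) : moebius z 0 = z := by simp [moebius]

lemma one_sub_conj_mul_moebius {z a : ℂ} (hz : ‖z‖ < 1) (ha : ‖a‖ < 1) :
    1 - conj z * moebius z a = (1 - (‖z‖ : ℂ) ^ 2) / (1 - conj z * a) := by
  have h := one_sub_conj_moebius_mul_moebius (a := 0) hz (by simp) ha
  simpa using h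

lemma moebius_moebius {z a : ℂ} (hz : ‖z‖ < 1) (ha : ‖a‖ < 1) : moebius z (moebius z a) = a := by
  have h1 := one_sub_conj_mul_ne_zero hz ha
  have h3 := one_sub_norm_sq_ne_zero hz
  rw [moebius, one_sub_conj_mul_moebius hz ha, moebius]
  rw [div_div_eq_mul_div, div_eq_iff h3, sub_mul, div_mul_cancel₀ _ h1, ← Complex.mul_conj']
  ring

lemma hasDerivAt_moebius {z a : ℂ} (hz : ‖z‖ < 1) (ha : ‖a‖ < 1) :
    HasDerivAt (moebius z) (-(1 - (‖z‖ : ℂ) ^ 2) / (1 - conj z * a) ^ 2) a := by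
  have h1 := one_sub_conj_mul_ne_zero hz ha
  have h := ((hasDerivAt_id a).const_sub z).div
    (((hasDerivAt_id a).const_mul (conj z)).const_sub 1) h1
  refine h.congr_deriv ?_
  rw [← Complex.mul_conj']
  simp only [id]
  ring

lemma measurable_moebius (z : ℂ) : Measurable (moebius z) := by
  unfold moebius
  fun_prop

lemma image_moebius_ball {z : ℂ} (hz : ‖z‖ < 1) : moebius z '' ball 0 1 = ball 0 1 := by
  ext w
  simp only [mem_image, mem_ball_zero_iff]
  exact ⟨fun ⟨a, ha, h⟩ => h ▸ norm_moebius_lt_one hz ha,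
    fun hw => ⟨moebius z w, norm_moebius_lt_one hz hw, moebius_moebius hz hw⟩⟩

lemma injOn_moebius {z : ℂ} (hz : ‖z‖ < 1) : InjOn (moebius z) (ball 0 1) := by
  intro a ha b hb h
  rw [mem_ball_zero_iff] at ha hb
  rw [← moebius_moebius hz ha, h, moebius_moebius hz hb]

/-! ### Change of variables -/

lemma ae_norm_lt_one : ∀ᵐ w ∂diskMeasure, ‖w‖ < 1 := by
  have : ∀ᵐ w ∂diskMeasure, w ∈ ball (0 : ℂ) 1 :=
    Measure.ae_smul_measure (ae_restrict_mem isOpen_ball.measurableSet) _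
  simpa using this

lemma lintegral_diskMeasure (f : ℂ → ℝ≥0∞) :
    ∫⁻ w, f w ∂diskMeasure = (volume (ball (0 : ℂ) 1))⁻¹ * ∫⁻ w in ball 0 1, f w := by
  rw [diskMeasure, lintegral_smul_measure, smul_eq_mul]

lemma integral_diskMeasure (f : ℂ → ℂ) :
    ∫ w, f w ∂diskMeasure = ((volume (ball (0 : ℂ) 1))⁻¹).toReal • ∫ w in ball 0 1, f w := by
  rw [diskMeasure, integral_smul_measure]

lemma integrable_diskMeasure_iff (f : ℂ → ℂ) :
    Integrable f diskMeasure ↔ IntegrableOn f (ball 0 1) := by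
  rw [diskMeasure, integrable_smul_measure, IntegrableOn]
  · exact ENNReal.inv_ne_zero.2 measure_ball_lt_top.ne
  · exact ENNReal.inv_ne_top.2 (measure_ball_pos volume _ one_pos).ne'

/-- The real Jacobian of `moebius z`. -/
def moebiusJac (z a : ℂ) : ℝ := (1 - ‖z‖ ^ 2) ^ 2 / ‖1 - conj z * a‖ ^ 4

/-- The real determinant of a complex-linear map is the field norm from ℂ to ℝ of its complex
determinant. -/
lemma abs_det_mul_eq (c : ℂ) :
    |((ContinuousLinearMap.toSpanSingleton ℂ c).restrictScalars ℝ).det| = ‖c‖ ^ 2 := by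
  have : (ContinuousLinearMap.toSpanSingleton ℂ c).toLinearMap = c • LinearMap.id := by
    ext; simp
  rw [ContinuousLinearMap.det, ContinuousLinearMap.coe_restrictScalars, this,
    LinearMap.det_restrictScalars]
  simp [Algebra.norm_complex_apply, Complex.normSq_eq_norm_sq]

lemma abs_det_moebius {z a : ℂ} (hz : ‖z‖ < 1) :
    |((ContinuousLinearMap.toSpanSingleton ℂ
      (-(1 - (‖z‖ : ℂ) ^ 2) / (1 - conj z * a) ^ 2)).restrictScalars ℝ).det| = moebiusJac z a := by
  have : ‖(1 - (‖z‖ : ℂ) ^ 2)‖ = 1 - ‖z‖ ^ 2 := by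
    rw [← Complex.ofReal_one, ← Complex.ofReal_pow, ← Complex.ofReal_sub, Complex.norm_real,
      Real.norm_of_nonneg (one_sub_norm_sq_pos hz).le]
  rw [abs_det_mul_eq, norm_div, norm_neg, norm_pow, this, moebiusJac, div_pow]
  ring

lemma hasFDerivWithinAt_moebius {z a : ℂ} (hz : ‖z‖ < 1) (ha : a ∈ ball (0 : ℂ) 1) :
    HasFDerivWithinAt (moebius z) ((ContinuousLinearMap.toSpanSingleton ℂ
      (-(1 - (‖z‖ : ℂ) ^ 2) / (1 - conj z * a) ^ 2)).restrictScalars ℝ) (ball 0 1) a :=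
  ((hasDerivAt_moebius hz (mem_ball_zero_iff.1 ha)).hasFDerivAt.restrictScalars
    ℝ).hasFDerivWithinAt

lemma lintegral_eq_lintegral_moebius {z : ℂ} (hz : ‖z‖ < 1) (f : ℂ → ℝ≥0∞) :
    ∫⁻ w, f w ∂diskMeasure =
      ∫⁻ a, ENNReal.ofReal (moebiusJac z a) * f (moebius z a) ∂diskMeasure := by
  rw [lintegral_diskMeasure, lintegral_diskMeasure]
  congr 1
  conv_lhs => rw [← image_moebius_ball hz]
  rw [lintegral_image_eq_lintegral_abs_det_fderiv_mul volume isOpen_ball.measurableSet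
    (fun a ha => hasFDerivWithinAt_moebius hz ha) (injOn_moebius hz)]
  simp_rw [abs_det_moebius hz]

lemma integral_eq_integral_moebius {z : ℂ} (hz : ‖z‖ < 1) (f : ℂ → ℂ) :
    ∫ w, f w ∂diskMeasure = ∫ a, moebiusJac z a • f (moebius z a) ∂diskMeasure := by
  rw [integral_diskMeasure, integral_diskMeasure]
  congr 1
  conv_lhs => rw [← image_moebius_ball hz]
  rw [integral_image_eq_integral_abs_det_fderiv_smul volume isOpen_ball.measurableSet
    (fun a ha => hasFDerivWithinAt_moebius hz ha) (injOn_moebius hz)]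
  simp_rw [abs_det_moebius hz]

lemma integrable_iff_integrable_moebius {z : ℂ} (hz : ‖z‖ < 1) (f : ℂ → ℂ) :
    Integrable f diskMeasure ↔
      Integrable (fun a => moebiusJac z a • f (moebius z a)) diskMeasure := by
  rw [integrable_diskMeasure_iff, integrable_diskMeasure_iff]
  conv_lhs => rw [← image_moebius_ball hz]
  rw [integrableOn_image_iff_integrableOn_abs_det_fderiv_smul volume isOpen_ball.measurableSet
    (fun a ha => hasFDerivWithinAt_moebius hz ha) (injOn_moebius hz)]
  simp_rw [abs_det_moebius hz]

/-! ### Rotations and the area mean value property -/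

lemma measurePreserving_mul_diskMeasure {c : ℂ} (hc : ‖c‖ = 1) :
    MeasurePreserving (fun w => c * w) diskMeasure diskMeasure := by
  have hm' : MeasurePreserving (fun w : ℂ => c * w) :=
    (rotation (⟨c, mem_sphere_zero_iff_norm.2 hc⟩ : Circle)).measurePreserving
  have h2 := hm'.restrict_preimage (s := ball 0 1) isOpen_ball.measurableSet
  have h3 : (fun w : ℂ => c * w) ⁻¹' ball 0 1 = ball 0 1 := by
    ext w; simp [hc]
  rw [h3] at h2
  exact h2.smul_measure _

/-- By rotation invariance the integrand may be averaged over all rotations; after Fubini the inner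
average over the circle through w is `g 0` by the mean value property. Integrability suffices, with
no boundary regularity of g. -/
lemma integral_diskMeasure_eq_apply_zero {g : ℂ → ℂ} (hg : DifferentiableOn ℂ g (ball 0 1))
    (hi : Integrable g diskMeasure) : ∫ w, g w ∂diskMeasure = g 0 := by
  have hc : ∀ θ : ℝ, ‖circleMap 0 1 θ‖ = 1 := fun θ => by simp
  have h1 : ∀ θ : ℝ, ∫ w, g (circleMap 0 1 θ * w) ∂diskMeasure = ∫ w, g w ∂diskMeasure := by
    intro θ
    have := (measurePreserving_mul_diskMeasure (hc θ)).integral_comp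
      (measurableEmbedding_mulLeft₀ (by rw [← norm_pos_iff, hc]; exact one_pos)) g
    exact this
  have h2 : ∀ᵐ w ∂diskMeasure, ∫ θ in (0)..2 * Real.pi, g (circleMap 0 1 θ * w)
      = (2 * Real.pi) • g 0 := by
    filter_upwards [ae_norm_lt_one] with w hw
    have hd : DifferentiableOn ℂ (fun ζ => g (ζ * w)) (closedBall 0 1) := by
      refine hg.comp (by fun_prop) ?_
      intro ζ hζ
      rw [mem_closedBall_zero_iff] at hζ
      rw [mem_ball_zero_iff, norm_mul]
      nlinarith [norm_nonneg w]
    have h := DiffContOnCl.circleAverage (R := 1) (c := 0) (f := fun ζ => g (ζ * w))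
      (by rw [abs_one]; exact hd.diffContOnCl_ball subset_rfl)
    rw [Real.circleAverage_def, zero_mul] at h
    rw [← h, smul_smul, mul_inv_cancel₀ Real.two_pi_pos.ne', one_smul]
  -- Fubini needs joint integrability, which holds because the skew rotation (θ, w) ↦ (θ, e^{iθ} w)
  -- preserves the product measure.
  have h3 : Integrable (fun p : ℝ × ℂ => g (circleMap 0 1 p.1 * p.2))
      ((volume.restrict (Ioc 0 (2 * Real.pi))).prod diskMeasure) := by
    have hmp : MeasurePreserving (fun p : ℝ × ℂ => (p.1, circleMap 0 1 p.1 * p.2))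
        ((volume.restrict (Ioc 0 (2 * Real.pi))).prod diskMeasure)
        ((volume.restrict (Ioc 0 (2 * Real.pi))).prod diskMeasure) := by
      refine (MeasurePreserving.id _).skew_product (g := fun θ w => circleMap 0 1 θ * w) ?_ ?_
      · exact ((continuous_circleMap 0 1).measurable.comp measurable_fst).mul measurable_snd
      · exact Eventually.of_forall fun θ => (measurePreserving_mul_diskMeasure (hc θ)).map_eq
    exact hmp.integrable_comp_of_integrable (hi.comp_snd _)
  have h4 := integral_integral_swap
    (f := fun (θ : ℝ) (w : ℂ) => g (circleMap 0 1 θ * w)) h3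
  simp_rw [h1] at h4
  rw [integral_const, integral_congr_ae
    (f := fun w => ∫ θ in Ioc 0 (2 * Real.pi), g (circleMap 0 1 θ * w))
    (g := fun _ => (2 * Real.pi) • g 0)] at h4
  · rw [integral_const] at h4
    simp only [measureReal_restrict_apply MeasurableSet.univ, univ_inter, probReal_univ,
      Real.volume_real_Ioc_of_le Real.two_pi_pos.le, sub_zero, one_smul] at h4
    exact smul_right_injective ℂ Real.two_pi_pos.ne' h4
  · filter_upwards [h2] with w hw
    rw [← hw, intervalIntegral.integral_of_le Real.two_pi_pos.le]

/-! ### The Bergman kernel in closed form -/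

/-- The function `(1 - z̄ w)⁻²`. -/
def kernelFun (z w : ℂ) : ℂ := ((1 - conj z * w) ^ 2)⁻¹

lemma measurable_kernelFun (z : ℂ) : Measurable (kernelFun z) := by
  unfold kernelFun; fun_prop

@[simp] lemma kernelFun_zero_left (w : ℂ) : kernelFun 0 w = 1 := by simp [kernelFun]

lemma kernelFun_self (z : ℂ) : kernelFun z z = (((1 - ‖z‖ ^ 2) ^ 2)⁻¹ : ℝ) := by
  simp [kernelFun, Complex.conj_mul']

lemma norm_kernelFun (z w : ℂ) : ‖kernelFun z w‖ = (‖1 - conj z * w‖ ^ 2)⁻¹ := by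
  simp [kernelFun]

lemma norm_kernelFun_le {z w : ℂ} (hz : ‖z‖ < 1) (hw : ‖w‖ ≤ 1) :
    ‖kernelFun z w‖ ≤ ((1 - ‖z‖) ^ 2)⁻¹ := by
  have h1 : 1 - ‖z‖ ≤ ‖1 - conj z * w‖ := by
    have := one_sub_norm_le_norm_one_sub_mul (b := conj z) hw
    rwa [mul_comm, RCLike.norm_conj] at this
  rw [norm_kernelFun]
  have : 0 < 1 - ‖z‖ := by linarith
  gcongr

lemma differentiableOn_kernelFun {z : ℂ} (hz : ‖z‖ < 1) :
    DifferentiableOn ℂ (kernelFun z) (ball 0 1) := by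
  unfold kernelFun
  refine DifferentiableOn.inv (by fun_prop) fun w hw => ?_
  exact pow_ne_zero _ (one_sub_conj_mul_ne_zero hz (mem_ball_zero_iff.1 hw))

lemma ae_norm_kernelFun_le {z : ℂ} (hz : ‖z‖ < 1) :
    ∀ᵐ w ∂diskMeasure, ‖kernelFun z w‖ ≤ ((1 - ‖z‖) ^ 2)⁻¹ := by
  filter_upwards [ae_norm_lt_one] with w hw using norm_kernelFun_le hz hw.le

lemma memLp_kernelFun {z : ℂ} (hz : ‖z‖ < 1) (p : ℝ≥0∞) : MemLp (kernelFun z) p diskMeasure :=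
  MemLp.of_bound (measurable_kernelFun z).aestronglyMeasurable _ (ae_norm_kernelFun_le hz)

lemma kernelFun_moebius_moebius {z a b : ℂ} (hz : ‖z‖ < 1) (ha : ‖a‖ < 1) (hb : ‖b‖ < 1) :
    kernelFun (moebius z a) (moebius z b) =
      ((1 - z * conj a) * (1 - conj z * b)) ^ 2 / (1 - (‖z‖ : ℂ) ^ 2) ^ 2 * kernelFun a b := by
  rw [kernelFun, one_sub_conj_moebius_mul_moebius hz ha hb, kernelFun]
  rw [div_pow, mul_pow (1 - (‖z‖ : ℂ) ^ 2), inv_div, div_mul_eq_div_mul_one_div]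
  ring

lemma kernelFun_moebius {z b : ℂ} (hz : ‖z‖ < 1) (hb : ‖b‖ < 1) :
    kernelFun z (moebius z b) = (1 - conj z * b) ^ 2 / (1 - (‖z‖ : ℂ) ^ 2) ^ 2 := by
  simpa using kernelFun_moebius_moebius (a := 0) hz (by simp) hb

lemma moebiusJac_eq (z b : ℂ) : (moebiusJac z b : ℂ) =
    (1 - (‖z‖ : ℂ) ^ 2) ^ 2 / ((1 - conj z * b) ^ 2 * conj ((1 - conj z * b) ^ 2)) := by
  rw [Complex.mul_conj']
  simp [moebiusJac]
  congr 1
  ring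

/-- Under the substitution φ_z, the Jacobian times conj K_z ∘ φ_z is again K_z, now without
conjugation. The integrand becomes the analytic function K_z · (g ∘ φ_z), whose value at 0 is g(z).
-/
lemma integral_conj_kernelFun_mul {g : ℂ → ℂ} (hg : DifferentiableOn ℂ g (ball 0 1))
    (hi : Integrable g diskMeasure) {z : ℂ} (hz : ‖z‖ < 1) :
    ∫ w, conj (kernelFun z w) * g w ∂diskMeasure = g z := by
  have key : ∀ᵐ a ∂diskMeasure,
      moebiusJac z a • (conj (kernelFun z (moebius z a)) * g (moebius z a)) =
      kernelFun z a * g (moebius z a) := by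
    filter_upwards [ae_norm_lt_one] with a ha
    have h1 := one_sub_conj_mul_ne_zero hz ha
    have h1' : conj (1 - conj z * a) ≠ 0 := (map_ne_zero _).2 h1
    have h2 := one_sub_norm_sq_ne_zero hz
    have h3 : conj (1 - (‖z‖ : ℂ) ^ 2) = 1 - (‖z‖ : ℂ) ^ 2 := by simp
    rw [Complex.real_smul, ← mul_assoc, kernelFun_moebius hz ha, moebiusJac_eq, kernelFun]
    congr 1
    rw [map_div₀, map_pow, map_pow, h3]
    field_simp
  have hi2 : Integrable (fun w => conj (kernelFun z w) * g w) diskMeasure := by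
    refine hi.bdd_mul (c := ((1 - ‖z‖) ^ 2)⁻¹) ?_ ?_
    · exact (Complex.continuous_conj.measurable.comp (measurable_kernelFun z)).aestronglyMeasurable
    · simpa using ae_norm_kernelFun_le hz
  have hi3 := ((integrable_iff_integrable_moebius hz _).1 hi2).congr key
  rw [integral_eq_integral_moebius hz, integral_congr_ae key,
    integral_diskMeasure_eq_apply_zero _ hi3]
  · simp [kernelFun]
  · refine (differentiableOn_kernelFun hz).mul (hg.comp ?_ ?_)
    · intro a ha
      exact (hasDerivAt_moebius hz
        (mem_ball_zero_iff.1 ha)).differentiableAt.differentiableWithinAt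
    · intro a ha
      exact mem_ball_zero_iff.2 (norm_moebius_lt_one hz (mem_ball_zero_iff.1 ha))

lemma bergmanKernel_ae_eq (z : 𝔻) :
    (bergmanKernel z : Lp ℂ 2 diskMeasure) =ᵐ[diskMeasure] kernelFun z := by
  have hz := z.norm_lt_one
  let k : bergmanSpace := ⟨(memLp_kernelFun hz 2).toLp, kernelFun z,
    differentiableOn_kernelFun hz, MemLp.coeFn_toLp _⟩
  have hk : ((k : Lp ℂ 2 diskMeasure) : ℂ → ℂ) =ᵐ[diskMeasure] kernelFun z :=
    MemLp.coeFn_toLp (memLp_kernelFun hz 2)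
  have : bergmanKernel z = k := by
    refine ext_inner_right ℂ fun f => ?_
    rw [inner_bergmanKernel]
    have hfi : Integrable (bergmanSpace.rep f) diskMeasure :=
      ((Lp.memLp (f : Lp ℂ 2 diskMeasure)).integrable one_le_two).congr
        (bergmanSpace.coe_ae_eq_rep f)
    rw [bergmanSpace.apply_eq (bergmanSpace.differentiableOn_rep f) (bergmanSpace.coe_ae_eq_rep f),
      ← integral_conj_kernelFun_mul (bergmanSpace.differentiableOn_rep f) hfi hz,
      Submodule.coe_inner, L2.inner_def]
    refine integral_congr_ae ?_
    filter_upwards [hk, bergmanSpace.coe_ae_eq_rep f] with w h1 h2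
    rw [h1, h2, RCLike.inner_apply, mul_comm]
  rw [this]
  exact hk

lemma bergmanKernel_apply (z w : 𝔻) : bergmanKernel z w = kernelFun z w :=
  bergmanSpace.apply_eq (differentiableOn_kernelFun z.norm_lt_one) (bergmanKernel_ae_eq z) w

lemma norm_bergmanKernel (z : 𝔻) : ‖bergmanKernel z‖ = (1 - ‖(z : ℂ)‖ ^ 2)⁻¹ := by
  have h := inner_self_eq_norm_sq_to_K (𝕜 := ℂ) (bergmanKernel z)
  rw [inner_bergmanKernel, bergmanKernel_apply, kernelFun_self] at h
  have h' : ((1 - ‖(z : ℂ)‖ ^ 2)⁻¹) ^ 2 = ‖bergmanKernel z‖ ^ 2 := by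
    rw [inv_pow]
    exact Complex.ofReal_injective (by simpa using h)
  have := one_sub_norm_sq_pos z.norm_lt_one
  exact ((sq_eq_sq₀ (by positivity) (norm_nonneg _)).1 h').symm

lemma normalizedKernel_eq (z : 𝔻) :
    normalizedKernel z = (1 - (‖(z : ℂ)‖ : ℂ) ^ 2) • bergmanKernel z := by
  rw [normalizedKernel, norm_bergmanKernel]
  simp

lemma norm_normalizedKernel (z : 𝔻) : ‖normalizedKernel z‖ = 1 := by
  have h := one_sub_norm_sq_pos z.norm_lt_one
  rw [normalizedKernel, norm_smul, norm_inv, Complex.norm_real, norm_norm, inv_mul_cancel₀]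
  rw [norm_bergmanKernel]
  positivity

/-! ### The integral kernel of a Toeplitz operator -/

/-- The value at `w` of the Toeplitz operator with symbol `u` applied to the kernel at `z`. -/
def toeplitzKernel (u : ℂ → ℂ) (w z : ℂ) : ℂ :=
  ∫ ζ, u ζ * (kernelFun z ζ * conj (kernelFun w ζ)) ∂diskMeasure

lemma inner_toeplitz (u : Lp ℂ ∞ diskMeasure) (f g : bergmanSpace) :
    inner ℂ f (toeplitz u g) =
      ∫ w, u w * ((g : Lp ℂ 2 diskMeasure) w * conj ((f : Lp ℂ 2 diskMeasure) w))
        ∂diskMeasure := by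
  simp only [toeplitz, ContinuousLinearMap.comp_apply]
  rw [Submodule.inner_orthogonalProjectionOnto_eq_of_mem_left, L2.inner_def]
  refine integral_congr_ae ?_
  filter_upwards [(ContinuousLinearMap.mul ℂ ℂ).coeFn_holder (r := 2) u
    (g : Lp ℂ 2 diskMeasure)] with w hw
  rw [show mulOp u (bergmanSpace.subtypeL g) =
    (ContinuousLinearMap.mul ℂ ℂ).holder 2 u (g : Lp ℂ 2 diskMeasure) from rfl, hw]
  simp only [RCLike.inner_apply, ContinuousLinearMap.mul_apply']
  rw [mul_assoc]

lemma toeplitz_bergmanKernel_apply {u : Lp ℂ ∞ diskMeasure} {v : ℂ → ℂ}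
    (huv : u =ᵐ[diskMeasure] v) (w z : 𝔻) :
    toeplitz u (bergmanKernel z) w = toeplitzKernel v w z := by
  rw [← inner_bergmanKernel, inner_toeplitz, toeplitzKernel]
  refine integral_congr_ae ?_
  filter_upwards [huv, bergmanKernel_ae_eq z, bergmanKernel_ae_eq w] with ζ h1 h2 h3
  rw [h1, h2, h3]

lemma berezinSymbol_eq {u : Lp ℂ ∞ diskMeasure} {v : ℂ → ℂ}
    (huv : u =ᵐ[diskMeasure] v) (z : 𝔻) :
    berezinSymbol u z = (1 - (‖(z : ℂ)‖ : ℂ) ^ 2) ^ 2 * toeplitzKernel v z z := by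
  rw [berezinSymbol, berezin, normalizedKernel_eq, map_smul,
    inner_smul_left (𝕜 := ℂ) (E := bergmanSpace), inner_smul_right (𝕜 := ℂ) (E := bergmanSpace),
    inner_bergmanKernel, toeplitz_bergmanKernel_apply huv]
  simp
  ring

/-- Substituting φ_z in the integral, all factors containing the integration variable cancel between
the Jacobian and the two kernels. This is the unitary equivalence of T_u and T_{u∘φ_z}, seen on
integral kernels. -/
lemma toeplitzKernel_moebius (u : ℂ → ℂ) {z a b : ℂ} (hz : ‖z‖ < 1) (ha : ‖a‖ < 1)
    (hb : ‖b‖ < 1) :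
    toeplitzKernel u (moebius z a) (moebius z b) =
      ((1 - conj z * a) * (1 - z * conj b)) ^ 2 / (1 - (‖z‖ : ℂ) ^ 2) ^ 2 *
        toeplitzKernel (fun ζ => u (moebius z ζ)) a b := by
  rw [toeplitzKernel, integral_eq_integral_moebius hz, toeplitzKernel, ← integral_const_mul]
  refine integral_congr_ae ?_
  filter_upwards [ae_norm_lt_one] with ζ hζ
  have h1 := one_sub_conj_mul_ne_zero hz hζ
  have h1' : conj (1 - conj z * ζ) ≠ 0 := (map_ne_zero _).2 h1
  have h2 := one_sub_norm_sq_ne_zero hz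
  have h3 : conj (1 - (‖z‖ : ℂ) ^ 2) = 1 - (‖z‖ : ℂ) ^ 2 := by simp
  have h4 : conj (1 - z * conj a) = 1 - conj z * a := by simp
  rw [Complex.real_smul, kernelFun_moebius_moebius hz hb hζ, kernelFun_moebius_moebius hz ha hζ,
    moebiusJac_eq]
  simp only [map_mul, map_div₀, map_pow, h3, h4]
  field_simp

/-- A representative bounded at every point can be composed with all φ_z at once, without tracking
null sets. -/
lemma exists_bounded_representative (u : Lp ℂ ∞ diskMeasure) :
    ∃ v : ℂ → ℂ, Measurable v ∧ (∃ M : ℝ, 0 ≤ M ∧ ∀ w, ‖v w‖ ≤ M) ∧ u =ᵐ[diskMeasure] v := by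
  have hm := (Lp.stronglyMeasurable u).measurable
  refine ⟨{w | ‖u w‖ ≤ ‖u‖}.indicator u, hm.indicator (measurableSet_le hm.norm measurable_const),
    ⟨‖u‖, norm_nonneg _, fun w => ?_⟩, ?_⟩
  · by_cases h : ‖u w‖ ≤ ‖u‖
    · rwa [indicator_of_mem (by exact h)]
    · rw [indicator_of_notMem (by exact h)]; simp
  · have : ∀ᵐ w ∂diskMeasure, ‖u w‖ ≤ ‖u‖ := by
      have h := ae_le_eLpNormEssSup (f := u) (μ := diskMeasure)
      filter_upwards [h] with w hw
      rw [← eLpNorm_exponent_top, ← Lp.enorm_def] at hw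
      exact enorm_le_iff_norm_le.1 hw
    filter_upwards [this] with w hw
    rw [indicator_of_mem (by exact hw)]

/-! ### Approach to the boundary -/

/-- `moebius` as a map of the unit disk. -/
def moebiusDisc (z a : 𝔻) : 𝔻 :=
  Complex.UnitDisc.mk (moebius z a) (norm_moebius_lt_one z.norm_lt_one a.norm_lt_one)

@[simp] lemma coe_moebiusDisc (z a : 𝔻) : (moebiusDisc z a : ℂ) = moebius z a := rfl

lemma tendsto_norm_toBoundary : Tendsto (fun z : 𝔻 => ‖(z : ℂ)‖) toBoundary (𝓝 1) :=
  tendsto_comap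

instance : toBoundary.IsCountablyGenerated := by
  unfold toBoundary; infer_instance

/-- For fixed a, 1 - |φ_z(a)|² ≤ (1 - |z|²) / (1 - |a|)². -/
lemma tendsto_moebiusDisc (a : 𝔻) :
    Tendsto (fun z => moebiusDisc z a) toBoundary toBoundary := by
  refine tendsto_comap_iff.2 ?_
  have ha : 0 < 1 - ‖(a : ℂ)‖ := by linarith [a.norm_lt_one]
  have hlow : Tendsto (fun z : 𝔻 => 1 - (1 - ‖(z : ℂ)‖ ^ 2) / (1 - ‖(a : ℂ)‖) ^ 2)
      toBoundary (𝓝 1) := by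
    have := (((tendsto_norm_toBoundary.pow 2).const_sub 1).div_const
      ((1 - ‖(a : ℂ)‖) ^ 2)).const_sub 1
    simpa using this
  refine tendsto_of_tendsto_of_tendsto_of_le_of_le hlow tendsto_const_nhds (fun z => ?_)
    fun z => (moebiusDisc z a).norm_lt_one.le
  have h1 := one_sub_norm_moebius_sq z.norm_lt_one a.norm_lt_one
  have h2 := one_sub_norm_le_norm_one_sub_mul (a := conj (z : ℂ)) (b := a)
    (by simpa using z.norm_lt_one.le)
  have h3 := (moebiusDisc z a).norm_lt_one
  have hz := one_sub_norm_sq_pos z.norm_lt_one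
  have h4 : (1 - ‖(z : ℂ)‖ ^ 2) * (1 - ‖(a : ℂ)‖ ^ 2) / ‖1 - conj (z : ℂ) * a‖ ^ 2 ≤
      (1 - ‖(z : ℂ)‖ ^ 2) / (1 - ‖(a : ℂ)‖) ^ 2 := by
    gcongr
    nlinarith [norm_nonneg (a : ℂ)]
  simp only [Function.comp_apply, coe_moebiusDisc] at h3 ⊢
  nlinarith [norm_nonneg (moebius z a)]

lemma berezinSymbol_moebiusDisc {u : Lp ℂ ∞ diskMeasure} {v : ℂ → ℂ}
    (huv : u =ᵐ[diskMeasure] v) (z a : 𝔻) :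
    berezinSymbol u (moebiusDisc z a) =
      (1 - (‖(a : ℂ)‖ : ℂ) ^ 2) ^ 2 * toeplitzKernel (fun ζ => v (moebius z ζ)) a a := by
  have hz := z.norm_lt_one
  have ha := a.norm_lt_one
  rw [berezinSymbol_eq huv, coe_moebiusDisc, toeplitzKernel_moebius v hz ha ha]
  have h1 : (1 - (‖moebius z a‖ : ℂ) ^ 2) = (1 - (‖(z : ℂ)‖ : ℂ) ^ 2) * (1 - (‖(a : ℂ)‖ : ℂ) ^ 2) /
      ((1 - z * conj (a : ℂ)) * (1 - conj (z : ℂ) * a)) := by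
    rw [← Complex.conj_mul', one_sub_conj_moebius_mul_moebius hz ha ha, Complex.conj_mul']
  have h2 := one_sub_mul_conj_ne_zero hz ha
  have h3 := one_sub_conj_mul_ne_zero hz ha
  have h4 := one_sub_norm_sq_ne_zero hz
  rw [h1, ← mul_assoc]
  congr 1
  rw [← mul_div_assoc, ← mul_pow, ← div_pow]
  congr 1
  rw [div_mul_eq_mul_div, div_div, div_eq_iff (mul_ne_zero (mul_ne_zero h2 h3) h4)]
  ring

/-! ### Weak vanishing of the translates of a symbol -/

/-- The integral of `ψ` against the translates `v ∘ φ_z` tends to `0` as `z` tends to the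
boundary. -/
def TranslatesVanish (v ψ : ℂ → ℂ) : Prop :=
  Tendsto (fun z : 𝔻 => ∫ η, v (moebius z η) * ψ η ∂diskMeasure) toBoundary (𝓝 0)

lemma integrable_translate_mul {v ψ : ℂ → ℂ} (hv : Measurable v) {M : ℝ} (hM : ∀ w, ‖v w‖ ≤ M)
    (hψ : Integrable ψ diskMeasure) (z : ℂ) :
    Integrable (fun η => v (moebius z η) * ψ η) diskMeasure :=
  hψ.bdd_mul (hv.comp (measurable_moebius z)).aestronglyMeasurable
    (Eventually.of_forall fun _ => hM _)

/-- The translates of v share the bound M and the measure is a probability, so a uniform error δ in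
ψ costs at most M δ, whatever z is. -/
lemma TranslatesVanish.of_approx {v ψ : ℂ → ℂ} (hv : Measurable v) {M : ℝ}
    (hM : ∀ w, ‖v w‖ ≤ M) (hψ : Integrable ψ diskMeasure)
    (h : ∀ ε > 0, ∃ ψ' : ℂ → ℂ, Integrable ψ' diskMeasure ∧ TranslatesVanish v ψ' ∧
      ∀ η, ‖η‖ < 1 → ‖ψ η - ψ' η‖ ≤ ε) : TranslatesVanish v ψ := by
  have hM0 : 0 ≤ M := (norm_nonneg _).trans (hM 0)
  rw [TranslatesVanish, Metric.tendsto_nhds]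
  intro ε hε
  obtain ⟨ψ', hi, hV, hψ'⟩ := h (ε / (2 * (M + 1))) (by positivity)
  filter_upwards [Metric.tendsto_nhds.1 hV (ε / 2) (by positivity)] with z hz
  rw [dist_zero_right] at hz ⊢
  have hd : ‖∫ η, v (moebius z η) * ψ η - v (moebius z η) * ψ' η ∂diskMeasure‖ ≤
      M * (ε / (2 * (M + 1))) := by
    refine (norm_integral_le_of_norm_le_const (C := M * (ε / (2 * (M + 1)))) ?_).trans_eq
      (by simp)
    filter_upwards [ae_norm_lt_one] with η hη
    rw [← mul_sub, norm_mul]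
    exact mul_le_mul (hM _) (hψ' η hη) (norm_nonneg _) hM0
  rw [integral_sub (integrable_translate_mul hv hM hψ z) (integrable_translate_mul hv hM hi z)]
    at hd
  have h2 : M * (ε / (2 * (M + 1))) < ε / 2 := by
    rw [← mul_div_assoc, div_lt_div_iff₀ (by positivity) (by positivity)]
    nlinarith
  have h3 := norm_le_norm_sub_add (∫ η, v (moebius z η) * ψ η ∂diskMeasure)
    (∫ η, v (moebius z η) * ψ' η ∂diskMeasure)
  linarith

lemma TranslatesVanish.sum {v : ℂ → ℂ} (hv : Measurable v) {M : ℝ} (hM : ∀ w, ‖v w‖ ≤ M)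
    {ι : Type*} (s : Finset ι) (c : ι → ℂ) {ψ : ι → ℂ → ℂ}
    (hψ : ∀ i ∈ s, Integrable (ψ i) diskMeasure) (h : ∀ i ∈ s, TranslatesVanish v (ψ i)) :
    TranslatesVanish v (fun η => ∑ i ∈ s, c i * ψ i η) := by
  have h1 := tendsto_finsetSum s fun i hi => (h i hi).const_mul (c i)
  simp only [mul_zero, Finset.sum_const_zero] at h1
  refine h1.congr fun z => ?_
  simp_rw [Finset.mul_sum, mul_left_comm _ (c _)]
  rw [integral_finsetSum]
  · simp_rw [integral_const_mul]
  · exact fun i hi => (integrable_translate_mul hv hM (hψ i hi) z).const_mul _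

lemma integrable_kernelFun_mul_conj {a b : ℂ} (ha : ‖a‖ < 1) (hb : ‖b‖ < 1) :
    Integrable (fun η => kernelFun b η * conj (kernelFun a η)) diskMeasure := by
  refine ((memLp_kernelFun hb 1).integrable le_rfl).mul_bdd (c := ((1 - ‖a‖) ^ 2)⁻¹) ?_ ?_
  · exact (Complex.continuous_conj.measurable.comp (measurable_kernelFun a)).aestronglyMeasurable
  · simpa using ae_norm_kernelFun_le ha

/-- Up to a constant depending on a, the integral is the Berezin transform at φ_z(a), and φ_z(a)
goes to the boundary with z. -/
lemma translatesVanish_norm_kernelFun_sq {u : Lp ℂ ∞ diskMeasure} {v : ℂ → ℂ}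
    (huv : u =ᵐ[diskMeasure] v) (h : Tendsto (berezinSymbol u) toBoundary (𝓝 0)) {a : ℂ}
    (ha : ‖a‖ < 1) : TranslatesVanish v (fun η => kernelFun a η * conj (kernelFun a η)) := by
  lift a to 𝔻 using ha
  have h1 := (h.comp (tendsto_moebiusDisc a)).const_mul ((1 - (‖(a : ℂ)‖ : ℂ) ^ 2) ^ 2)⁻¹
  rw [mul_zero] at h1
  refine h1.congr fun z => ?_
  rw [Function.comp_apply, berezinSymbol_moebiusDisc huv, inv_mul_cancel_left₀]
  · rfl
  · exact pow_ne_zero _ (one_sub_norm_sq_ne_zero a.norm_lt_one)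

/-! ### Uniform approximation of antiholomorphic monomials -/

/-- The Taylor polynomial of `(1 - x)⁻²`. -/
def invSqTaylor (k : ℕ) (x : ℂ) : ℂ := ∑ n ∈ Finset.range (k + 1), ((n : ℂ) + 1) * x ^ n

lemma one_sub_sq_mul_invSqTaylor (k : ℕ) (x : ℂ) :
    (1 - x) ^ 2 * invSqTaylor k x = 1 - (k + 2) * x ^ (k + 1) + (k + 1) * x ^ (k + 2) := by
  induction k with
  | zero => simp [invSqTaylor]; ring
  | succ k ih =>
    rw [invSqTaylor, Finset.sum_range_succ, mul_add, ← invSqTaylor, ih]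
    push_cast
    ring

lemma norm_inv_sq_sub_invSqTaylor_le (k : ℕ) {x : ℂ} (hx : ‖x‖ < 1) :
    ‖((1 - x) ^ 2)⁻¹ - invSqTaylor k x‖ ≤ (2 * k + 3) * ‖x‖ ^ (k + 1) / (1 - ‖x‖) ^ 2 := by
  have hx1 : 0 < 1 - ‖x‖ := by linarith
  have h0 : 1 - ‖x‖ ≤ ‖1 - x‖ := by simpa using norm_sub_norm_le 1 x
  have h1 : 1 - x ≠ 0 := norm_pos_iff.1 (by linarith)
  have h2 : ((1 - x) ^ 2)⁻¹ - invSqTaylor k x =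
      ((k + 2) - (k + 1) * x) * x ^ (k + 1) / (1 - x) ^ 2 := by
    rw [eq_div_iff (pow_ne_zero _ h1), sub_mul, inv_mul_cancel₀ (pow_ne_zero _ h1),
      mul_comm (invSqTaylor k x), one_sub_sq_mul_invSqTaylor]
    ring
  have h3 : ‖((k : ℂ) + 2) - (k + 1) * x‖ ≤ 2 * k + 3 := by
    have e1 : ‖(k : ℂ) + 2‖ = k + 2 := by exact_mod_cast Complex.norm_natCast (k + 2)
    have e2 : ‖(k : ℂ) + 1‖ = k + 1 := by exact_mod_cast Complex.norm_natCast (k + 1)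
    refine (norm_sub_le _ _).trans ?_
    rw [norm_mul, e1, e2]
    nlinarith [norm_nonneg x]
  rw [h2, norm_div, norm_mul, norm_pow, norm_pow]
  gcongr

/-- The total exponent n - m - k lies in [-2k, 0], so 2k + 1 divides it only if it is 0, which
forces n = k and m = 0. This is why roots of unity of order 2k + 1 are used. -/
lemma sum_rootsOfUnity_eq {k n m : ℕ} (hn : n ≤ k) (hm : m ≤ k) {ω : ℂ}
    (hω : IsPrimitiveRoot ω (2 * k + 1)) :
    ∑ j ∈ Finset.range (2 * k + 1), (ω ^ j) ^ n * ((ω ^ j)⁻¹ ^ m * (ω ^ j)⁻¹ ^ k) =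
      if n = k ∧ m = 0 then ((2 * k + 1 : ℕ) : ℂ) else 0 := by
  have hω0 : ω ≠ 0 := hω.ne_zero (by omega)
  have e : ∀ j : ℕ, (ω ^ j) ^ n * ((ω ^ j)⁻¹ ^ m * (ω ^ j)⁻¹ ^ k) =
      (ω ^ ((n : ℤ) - m - k)) ^ j := by
    intro j
    rw [zpow_sub₀ hω0, zpow_sub₀ hω0]
    simp only [zpow_natCast, div_pow, inv_pow, ← pow_mul]
    rw [mul_comm n j, mul_comm m j, mul_comm k j]
    field_simp
  simp_rw [e]
  split_ifs with h
  · obtain ⟨rfl, rfl⟩ := h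
    simp
  · have h1 : ω ^ ((n : ℤ) - m - k) ≠ 1 := by
      rw [Ne, hω.zpow_eq_one_iff_dvd]
      intro hd
      have : (n : ℤ) - m - k = 0 := by
        refine Int.eq_zero_of_abs_lt_dvd hd ?_
        rw [abs_lt]
        push_cast
        omega
      omega
    have h2 := mul_neg_geom_sum (ω ^ ((n : ℤ) - m - k)) (2 * k + 1)
    rw [← zpow_natCast, ← zpow_mul, mul_comm _ ((2 * k + 1 : ℕ) : ℤ), zpow_mul, zpow_natCast,
      hω.pow_eq_one, one_zpow, sub_self] at h2
    exact (mul_eq_zero.1 h2).resolve_left (sub_ne_zero.2 h1.symm)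

/-- A discrete Fourier coefficient: in the double expansion of |`invSqTaylor`|² the average over the
roots of unity keeps only the term of degree k in η̄ and 0 in η. -/
lemma sum_invSqTaylor_mul_conj (k : ℕ) {ω : ℂ} (hω : IsPrimitiveRoot ω (2 * k + 1))
    (hω1 : ‖ω‖ = 1) (r : ℝ) (η : ℂ) :
    ∑ j ∈ Finset.range (2 * k + 1), (ω ^ j)⁻¹ ^ k *
      (invSqTaylor k (r * ω ^ j * conj η) * conj (invSqTaylor k (r * ω ^ j * conj η))) =
      ((2 * k + 1 : ℕ) : ℂ) * ((k + 1) * r ^ k) * conj η ^ k := by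
  have hc : ∀ j : ℕ, conj (ω ^ j) = (ω ^ j)⁻¹ := by
    intro j
    rw [Complex.inv_eq_conj (by simp [hω1])]
  have e : ∀ j : ℕ, (ω ^ j)⁻¹ ^ k *
      (invSqTaylor k (r * ω ^ j * conj η) * conj (invSqTaylor k (r * ω ^ j * conj η))) =
      ∑ n ∈ Finset.range (k + 1), ∑ m ∈ Finset.range (k + 1),
        (((n : ℂ) + 1) * (r * conj η) ^ n * (((m : ℂ) + 1) * (r * η) ^ m)) *
        ((ω ^ j) ^ n * ((ω ^ j)⁻¹ ^ m * (ω ^ j)⁻¹ ^ k)) := by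
    intro j
    simp only [invSqTaylor, map_sum, map_mul, map_pow, map_add, map_one, map_natCast,
      Complex.conj_ofReal, Complex.conj_conj]
    rw [Finset.sum_mul_sum, Finset.mul_sum]
    refine Finset.sum_congr rfl fun n _ => ?_
    rw [Finset.mul_sum]
    refine Finset.sum_congr rfl fun m _ => ?_
    rw [← map_pow, hc]
    simp only [mul_pow]
    ring
  simp_rw [e]
  rw [Finset.sum_comm]
  have e2 : ∀ n ∈ Finset.range (k + 1), ∑ j ∈ Finset.range (2 * k + 1),
      ∑ m ∈ Finset.range (k + 1),
        (((n : ℂ) + 1) * (r * conj η) ^ n * (((m : ℂ) + 1) * (r * η) ^ m)) *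
        ((ω ^ j) ^ n * ((ω ^ j)⁻¹ ^ m * (ω ^ j)⁻¹ ^ k)) =
      ∑ m ∈ Finset.range (k + 1),
        (((n : ℂ) + 1) * (r * conj η) ^ n * (((m : ℂ) + 1) * (r * η) ^ m)) *
        (if n = k ∧ m = 0 then ((2 * k + 1 : ℕ) : ℂ) else 0) := by
    intro n hn
    rw [Finset.sum_comm]
    refine Finset.sum_congr rfl fun m hm => ?_
    rw [← Finset.mul_sum, sum_rootsOfUnity_eq (Finset.mem_range_succ_iff.1 hn)
      (Finset.mem_range_succ_iff.1 hm) hω]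
  rw [Finset.sum_congr rfl e2, Finset.sum_eq_single k, Finset.sum_eq_single 0]
  · simp
    ring
  · intro m _ hm
    simp [hm]
  · simp
  · intro n _ hn
    simp [hn]
  · simp

lemma norm_invSqTaylor_le (k : ℕ) {x : ℂ} (hx : ‖x‖ ≤ 1) :
    ‖invSqTaylor k x‖ ≤ ∑ n ∈ Finset.range (k + 1), ((n : ℝ) + 1) := by
  refine norm_sum_le_of_le _ fun n _ => ?_
  have e2 : ‖(n : ℂ) + 1‖ = n + 1 := by exact_mod_cast Complex.norm_natCast (n + 1)
  rw [norm_mul, norm_pow, e2]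
  exact mul_le_of_le_one_right (by positivity) (pow_le_one₀ (norm_nonneg _) hx)

/-- On the circle of radius r, replacing kernels by Taylor polynomials of degree k costs O(r^(k+1)),
while the extracted coefficient of η̄^k has size of order r^k. The quotient is O(r), with C
independent of r. -/
lemma exists_kernelFun_approx_conj_pow (k : ℕ) : ∃ C : ℝ, 0 ≤ C ∧ ∀ r : ℝ, 0 < r → r ≤ 1 / 2 →
    ∃ c l : ℕ → ℂ, (∀ j, ‖l j‖ < 1) ∧ ∀ η : ℂ, ‖η‖ < 1 →
      ‖conj η ^ k - ∑ j ∈ Finset.range (2 * k + 1),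
        c j * (kernelFun (l j) η * conj (kernelFun (l j) η))‖ ≤ C * r := by
  set A : ℝ := ∑ n ∈ Finset.range (k + 1), ((n : ℝ) + 1) with hA
  have hA0 : 0 ≤ A := Finset.sum_nonneg fun n _ => by positivity
  -- For |x| ≤ 1/2 the factor (1 - |x|)⁻² is at most 4: this gives the Taylor error (2k + 3) · 4 ·
  -- r^(k+1) and the bound 4 on the kernel, and A bounds the polynomial.
  set D : ℝ := (2 * k + 3) * 4 * (4 + A) with hD
  refine ⟨D, by positivity, fun r hr0 hr => ?_⟩
  set ω : ℂ := Complex.exp (2 * Real.pi * Complex.I / ((2 * k + 1 : ℕ) : ℂ)) with hωdef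
  have hω : IsPrimitiveRoot ω (2 * k + 1) := Complex.isPrimitiveRoot_exp _ (by omega)
  have hω1 : ‖ω‖ = 1 := hω.norm'_eq_one (by omega)
  set B : ℂ := ((2 * k + 1 : ℕ) : ℂ) * ((k + 1) * (r : ℂ) ^ k) with hB
  have hBn : ‖B‖ = (2 * k + 1) * ((k + 1) * r ^ k) := by
    have e1 : ‖((2 * k + 1 : ℕ) : ℂ)‖ = 2 * k + 1 := by
      rw [Complex.norm_natCast]; push_cast; ring
    have e2 : ‖(k : ℂ) + 1‖ = k + 1 := by exact_mod_cast Complex.norm_natCast (k + 1)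
    rw [hB, norm_mul, norm_mul, e1, e2, norm_pow, Complex.norm_real, Real.norm_of_nonneg hr0.le]
  have hB0 : B ≠ 0 := norm_pos_iff.1 (by rw [hBn]; positivity)
  refine ⟨fun j => B⁻¹ * (ω ^ j)⁻¹ ^ k, fun j => r * ω ^ j, fun j => ?_, fun η hη => ?_⟩
  · rw [norm_mul, norm_pow, hω1, one_pow, Complex.norm_real, Real.norm_of_nonneg hr0.le]
    linarith
  have h1 := sum_invSqTaylor_mul_conj k hω hω1 r η
  rw [← hB] at h1
  have h2 : conj η ^ k = ∑ j ∈ Finset.range (2 * k + 1), B⁻¹ * (ω ^ j)⁻¹ ^ k *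
      (invSqTaylor k (r * ω ^ j * conj η) * conj (invSqTaylor k (r * ω ^ j * conj η))) := by
    simp_rw [mul_assoc B⁻¹]
    rw [← Finset.mul_sum, h1, inv_mul_cancel_left₀ hB0]
  have hterm : ∀ j : ℕ, ‖invSqTaylor k (r * ω ^ j * conj η) *
      conj (invSqTaylor k (r * ω ^ j * conj η)) -
      kernelFun (r * ω ^ j) η * conj (kernelFun (r * ω ^ j) η)‖ ≤ D * r ^ (k + 1) := by
    intro j
    set x : ℂ := r * ω ^ j * conj η with hx
    have hxr : ‖x‖ ≤ r := by
      rw [hx, norm_mul, norm_mul, norm_pow, hω1, one_pow, Complex.norm_real,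
        Real.norm_of_nonneg hr0.le, RCLike.norm_conj]
      nlinarith
    have hker : kernelFun (r * ω ^ j) η = conj ((1 - x) ^ 2)⁻¹ := by
      simp [kernelFun, hx]
    set p := invSqTaylor k x
    set q := ((1 - x) ^ 2)⁻¹ with hq
    have hpq : ‖q - p‖ ≤ (2 * k + 3) * 4 * r ^ (k + 1) := by
      refine (norm_inv_sq_sub_invSqTaylor_le k (by linarith)).trans ?_
      rw [div_le_iff₀ (by nlinarith)]
      have e1 : ‖x‖ ^ (k + 1) ≤ r ^ (k + 1) := by gcongr
      have e2 : 1 ≤ 4 * (1 - ‖x‖) ^ 2 := by nlinarith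
      calc (2 * (k : ℝ) + 3) * ‖x‖ ^ (k + 1) ≤ (2 * k + 3) * r ^ (k + 1) := by gcongr
        _ ≤ (2 * k + 3) * r ^ (k + 1) * (4 * (1 - ‖x‖) ^ 2) :=
          le_mul_of_one_le_right (by positivity) e2
        _ = _ := by ring
    have hp : ‖p‖ ≤ A := norm_invSqTaylor_le k (by linarith)
    have hqn : ‖q‖ ≤ 4 := by
      have h0 : 1 - ‖x‖ ≤ ‖1 - x‖ := by simpa using norm_sub_norm_le 1 x
      rw [hq, norm_inv, norm_pow]
      refine inv_le_of_inv_le₀ (by norm_num) ?_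
      nlinarith
    rw [hker, Complex.conj_conj, mul_comm (conj q),
      show p * conj p - q * conj q = -((q - p) * conj q + p * conj (q - p)) by
        rw [map_sub]; ring, norm_neg]
    calc _ ≤ ‖q - p‖ * ‖q‖ + ‖p‖ * ‖q - p‖ := by
          refine (norm_add_le _ _).trans_eq ?_
          rw [norm_mul, norm_mul, RCLike.norm_conj, RCLike.norm_conj]
      _ = ‖q - p‖ * (‖q‖ + ‖p‖) := by ring
      _ ≤ ((2 * k + 3) * 4 * r ^ (k + 1)) * (4 + A) := by gcongr
      _ = _ := by rw [hD]; ring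
  rw [h2, ← Finset.sum_sub_distrib]
  calc _ ≤ ∑ j ∈ Finset.range (2 * k + 1), ‖B‖⁻¹ * (D * r ^ (k + 1)) := by
        refine norm_sum_le_of_le _ fun j _ => ?_
        rw [← mul_sub, norm_mul, norm_mul, norm_inv, norm_pow, norm_inv, norm_pow, hω1]
        simp only [one_pow, inv_one, mul_one]
        gcongr
        exact hterm j
    _ = D * r / (k + 1) := by
        rw [Finset.sum_const, Finset.card_range, hBn, nsmul_eq_mul]
        push_cast
        field_simp
        ring
    _ ≤ D * r := div_le_self (by positivity) (by linarith [Nat.cast_nonneg (α := ℝ) k])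

lemma integrable_of_continuous_disk {ψ : ℂ → ℂ} (hψ : Continuous ψ) : Integrable ψ diskMeasure := by
  rw [integrable_diskMeasure_iff]
  exact (hψ.continuousOn.integrableOn_compact (isCompact_closedBall 0 1)).mono_set
    ball_subset_closedBall

/-- Two uniform approximations: powers of η̄ by combinations of |K_l|² with small l, then conj K_a
by its Taylor polynomials in η̄. -/
lemma translatesVanish_conj_kernelFun {u : Lp ℂ ∞ diskMeasure} {v : ℂ → ℂ}
    (huv : u =ᵐ[diskMeasure] v) (hv : Measurable v) {M : ℝ} (hM : ∀ w, ‖v w‖ ≤ M)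
    (h : Tendsto (berezinSymbol u) toBoundary (𝓝 0)) {a : ℂ} (ha : ‖a‖ < 1) :
    TranslatesVanish v (fun η => conj (kernelFun a η)) := by
  have hpow : ∀ k : ℕ, TranslatesVanish v (fun η => conj η ^ k) := by
    intro k
    obtain ⟨C, hC0, hC⟩ := exists_kernelFun_approx_conj_pow k
    refine .of_approx hv hM (integrable_of_continuous_disk (by fun_prop)) fun ε hε => ?_
    obtain ⟨c, l, hl, happ⟩ := hC (min (1 / 2) (ε / (C + 1))) (by positivity) (min_le_left _ _)
    refine ⟨_, ?_, .sum hv hM _ c (fun j _ => integrable_kernelFun_mul_conj (hl j) (hl j))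
      fun j _ => translatesVanish_norm_kernelFun_sq huv h (hl j), fun η hη =>
      (happ η hη).trans ?_⟩
    · exact integrable_finsetSum _ fun j _ =>
        (integrable_kernelFun_mul_conj (hl j) (hl j)).const_mul _
    · calc C * min (1 / 2) (ε / (C + 1)) ≤ C * (ε / (C + 1)) := by
            gcongr; exact min_le_right _ _
        _ ≤ ε := by
            rw [← mul_div_assoc, div_le_iff₀ (by positivity)]
            nlinarith
  have hi : Integrable (fun η => conj (kernelFun a η)) diskMeasure := by
    simpa using integrable_kernelFun_mul_conj (b := 0) ha (by simp)
  refine .of_approx hv hM hi fun ε hε => ?_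
  have hlim : Tendsto (fun k : ℕ => (2 * (k : ℝ) + 3) * ‖a‖ ^ (k + 1) / (1 - ‖a‖) ^ 2)
      atTop (𝓝 0) := by
    have e1 := tendsto_self_mul_const_pow_of_lt_one (norm_nonneg a) ha
    have e2 := tendsto_pow_atTop_nhds_zero_of_lt_one (norm_nonneg a) ha
    have e3 := ((((e1.const_mul 2).add (e2.const_mul 3)).mul_const ‖a‖).div_const
      ((1 - ‖a‖) ^ 2))
    simp only [mul_zero, add_zero, zero_mul, zero_div] at e3
    refine e3.congr fun k => ?_
    ring
  obtain ⟨k, hk⟩ := (hlim.eventually_le_const hε).exists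
  refine ⟨fun η => ∑ n ∈ Finset.range (k + 1), (((n : ℂ) + 1) * a ^ n) * conj η ^ n, ?_,
    .sum hv hM _ _ (fun n _ => integrable_of_continuous_disk (by fun_prop)) fun n _ => hpow n,
    fun η hη => ?_⟩
  · exact integrable_of_continuous_disk (by fun_prop)
  · have hx : ‖a * conj η‖ ≤ ‖a‖ := by
      rw [norm_mul, RCLike.norm_conj]
      exact mul_le_of_le_one_right (norm_nonneg _) hη.le
    have e1 := norm_inv_sq_sub_invSqTaylor_le k (hx.trans_lt ha)
    have e2 : conj (kernelFun a η) = ((1 - a * conj η) ^ 2)⁻¹ := by simp [kernelFun]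
    have e3 : ∑ n ∈ Finset.range (k + 1), (((n : ℂ) + 1) * a ^ n) * conj η ^ n =
        invSqTaylor k (a * conj η) := by
      simp only [invSqTaylor, mul_pow, mul_assoc]
    simp only [e2, e3]
    refine e1.trans (le_trans ?_ hk)
    have : 0 < 1 - ‖a‖ := by linarith
    gcongr

/-- If the Berezin transform vanishes at the boundary, the functions `T_{u ∘ φ_z} 1` tend to `0`
pointwise. -/
lemma tendsto_toeplitzKernel_zero {u : Lp ℂ ∞ diskMeasure} {v : ℂ → ℂ}
    (huv : u =ᵐ[diskMeasure] v) (hv : Measurable v) {M : ℝ} (hM : ∀ w, ‖v w‖ ≤ M)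
    (h : Tendsto (berezinSymbol u) toBoundary (𝓝 0)) {a : ℂ} (ha : ‖a‖ < 1) :
    Tendsto (fun z : 𝔻 => toeplitzKernel (fun ζ => v (moebius z ζ)) a 0) toBoundary (𝓝 0) := by
  simpa [toeplitzKernel, TranslatesVanish] using translatesVanish_conj_kernelFun huv hv hM h ha

/-! ### Forelli–Rudin type estimates -/

/-- The squared modulus is (1 - ρ)² + 2ρ(1 - cos θ). The first term suffices for ρ ≤ 1/2, the second
for ρ ≥ 1/2. -/
lemma abs_div_two_pi_le_norm_one_sub {ρ θ : ℝ} (hρ0 : 0 ≤ ρ) (hρ : ρ ≤ 1) (hθ : |θ| ≤ Real.pi) :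
    |θ| / (2 * Real.pi) ≤ ‖(1 : ℂ) - ρ * (Real.cos θ + Real.sin θ * Complex.I)‖ := by
  refine abs_le_of_sq_le_sq' ?_ (norm_nonneg _) |>.2
  have h1 := Real.cos_le_one_sub_mul_cos_sq hθ
  have h2 := Real.neg_one_le_cos θ
  have h3 := Real.cos_le_one θ
  have h4 : ‖(1 : ℂ) - ρ * (Real.cos θ + Real.sin θ * Complex.I)‖ ^ 2 =
      (1 - ρ) ^ 2 + 2 * ρ * (1 - Real.cos θ) := by
    rw [← Complex.normSq_eq_norm_sq, Complex.normSq_apply]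
    simp only [Complex.sub_re, Complex.one_re, Complex.mul_re, Complex.ofReal_re, Complex.add_re,
      Complex.I_re, Complex.ofReal_im, Complex.I_im, Complex.add_im, Complex.mul_im,
      Complex.sub_im, Complex.one_im]
    nlinarith [Real.sin_sq_add_cos_sq θ]
  have h5 : (|θ| / (2 * Real.pi)) ^ 2 = (2 / Real.pi ^ 2 * θ ^ 2) / 8 := by
    rw [div_pow, sq_abs]
    field_simp
    norm_num
  rw [h4, h5]
  rcases le_total ρ (1 / 2) with h | h <;> nlinarith [sq_nonneg (1 - ρ)]

lemma lintegral_one_sub_rpow_lt_top {γ : ℝ} (hγ : γ < 1) :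
    ∫⁻ r in Ioo (0 : ℝ) 1, ENNReal.ofReal ((1 - r) ^ (-γ)) < ∞ := by
  have h := (intervalIntegral.intervalIntegrable_rpow' (a := 0) (b := 1)
    (show -1 < -γ by linarith)).comp_sub_left 1
  simp only [sub_zero, sub_self] at h
  have h2 := (intervalIntegrable_iff_integrableOn_Ioo_of_le zero_le_one).1 h.symm
  exact h2.lintegral_lt_top

lemma lintegral_abs_div_rpow_lt_top {γ : ℝ} (hγ : γ < 1) :
    ∫⁻ θ in Ioo (-Real.pi) Real.pi, ENNReal.ofReal ((|θ| / (2 * Real.pi)) ^ (-γ)) < ∞ := by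
  have h0 : IntervalIntegrable (fun θ : ℝ => (|θ| / (2 * Real.pi)) ^ (-γ)) volume 0 Real.pi := by
    refine ((intervalIntegral.intervalIntegrable_rpow' (a := 0) (b := Real.pi)
      (show -1 < -γ by linarith)).div_const ((2 * Real.pi) ^ (-γ))).congr ?_
    intro θ hθ
    rw [uIoc_of_le Real.pi_pos.le] at hθ
    simp only
    rw [abs_of_pos hθ.1, Real.div_rpow hθ.1.le Real.two_pi_pos.le]
  have h1 : IntervalIntegrable (fun θ : ℝ => (|θ| / (2 * Real.pi)) ^ (-γ)) volume
      (-Real.pi) 0 := by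
    have := (IntervalIntegrable.iff_comp_neg (f := fun θ : ℝ => (|θ| / (2 * Real.pi)) ^ (-γ))).1 h0
    simpa using this.symm
  have h2 := (intervalIntegrable_iff_integrableOn_Ioo_of_le (by linarith [Real.pi_pos])).1
    (h1.trans h0)
  exact h2.lintegral_lt_top

lemma exists_norm_eq_one_conj_mul (z : ℂ) : ∃ c : ℂ, ‖c‖ = 1 ∧ conj z * c = ‖z‖ := by
  rcases eq_or_ne z 0 with rfl | hz
  · exact ⟨1, by simp, by simp⟩
  · have hz' : (‖z‖ : ℂ) ≠ 0 := by simpa using hz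
    refine ⟨z / ‖z‖, by simp [hz], ?_⟩
    rw [← mul_div_assoc, Complex.conj_mul', sq, mul_div_assoc, div_self hz', mul_one]

/-- After rotating z to the positive axis, |1 - z̄a| is bounded below by the angle of a alone. In
polar coordinates the integral is then at most a product of two one-dimensional integrals free of z,
finite since γ < 1. -/
lemma exists_lintegral_norm_one_sub_rpow_le {γ : ℝ} (hγ0 : 0 ≤ γ) (hγ : γ < 1) :
    ∃ C : ℝ≥0∞, C ≠ ∞ ∧ ∀ z : ℂ, ‖z‖ < 1 →
      ∫⁻ a, ENNReal.ofReal (‖1 - conj z * a‖ ^ (-γ) * (1 - ‖a‖) ^ (-γ)) ∂diskMeasure ≤ C := by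
  refine ⟨(volume (ball (0 : ℂ) 1))⁻¹ *
    ((∫⁻ r in Ioo (0 : ℝ) 1, ENNReal.ofReal ((1 - r) ^ (-γ))) *
    ∫⁻ θ in Ioo (-Real.pi) Real.pi, ENNReal.ofReal ((|θ| / (2 * Real.pi)) ^ (-γ))),
    ENNReal.mul_ne_top (ENNReal.inv_ne_top.2 (measure_ball_pos volume _ one_pos).ne')
    (ENNReal.mul_ne_top (lintegral_one_sub_rpow_lt_top hγ).ne
      (lintegral_abs_div_rpow_lt_top hγ).ne), fun z hz => ?_⟩
  obtain ⟨c, hc, hcz⟩ := exists_norm_eq_one_conj_mul z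
  have hrot := (measurePreserving_mul_diskMeasure hc).lintegral_comp
    (f := fun a => ENNReal.ofReal (‖1 - conj z * a‖ ^ (-γ) * (1 - ‖a‖) ^ (-γ))) (by fun_prop)
  rw [← hrot, lintegral_diskMeasure]
  gcongr
  simp only [← mul_assoc, hcz, norm_mul, hc, one_mul]
  rw [← lintegral_indicator isOpen_ball.measurableSet, ← Complex.lintegral_comp_polarCoord_symm]
  set A : ℝ → ℝ≥0∞ := (Ioo (0 : ℝ) 1).indicator fun r => ENNReal.ofReal ((1 - r) ^ (-γ)) with hA
  set B : ℝ → ℝ≥0∞ := fun θ => ENNReal.ofReal ((|θ| / (2 * Real.pi)) ^ (-γ)) with hB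
  have hAm : Measurable A := Measurable.indicator (by fun_prop) measurableSet_Ioo
  have hBm : Measurable B := by fun_prop
  -- At angle 0 the majorant is not valid, since `0 ^ (-γ)` is 0 for γ ≠ 0.
  have hne : ∀ᵐ p : ℝ × ℝ, p.2 ≠ 0 :=
    Measure.quasiMeasurePreserving_snd.ae (Measure.ae_ne volume (0 : ℝ))
  calc _ ≤ ∫⁻ p in polarCoord.target, A p.1 * B p.2 := by
        refine setLIntegral_mono_ae (by fun_prop) ?_
        filter_upwards [hne] with p hp0 hp
        rw [polarCoord_target, mem_prod, mem_Ioi, mem_Ioo] at hp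
        obtain ⟨hr, hθ1, hθ2⟩ := hp
        rw [Complex.polarCoord_symm_apply]
        have hn : ‖(p.1 : ℂ) * (Real.cos p.2 + Real.sin p.2 * Complex.I)‖ = p.1 := by
          have := Complex.norm_polarCoord_symm p
          rw [Complex.polarCoord_symm_apply, abs_of_pos hr] at this
          exact this
        by_cases h1 : p.1 < 1
        · rw [indicator_of_mem (by rw [mem_ball_zero_iff, hn]; exact h1), hA,
            indicator_of_mem (show p.1 ∈ Ioo (0 : ℝ) 1 from ⟨hr, h1⟩), hn, hB, ← mul_assoc,
            ← Complex.ofReal_mul, smul_eq_mul,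
            ← ENNReal.ofReal_mul (by positivity),
            ← ENNReal.ofReal_mul (Real.rpow_nonneg (by linarith) _)]
          refine ENNReal.ofReal_le_ofReal ?_
          have hlow := abs_div_two_pi_le_norm_one_sub (ρ := ‖z‖ * p.1) (θ := p.2)
            (by positivity) (by nlinarith [norm_nonneg z]) (abs_le.2 ⟨hθ1.le, hθ2.le⟩)
          have hpos : 0 < |p.2| / (2 * Real.pi) := by positivity
          have e1 := Real.rpow_le_rpow_of_nonpos hpos hlow (neg_nonpos.2 hγ0)
          have e2 : 0 ≤ (1 - p.1) ^ (-γ) := Real.rpow_nonneg (by linarith) _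
          calc _ ≤ 1 * ((|p.2| / (2 * Real.pi)) ^ (-γ) * (1 - p.1) ^ (-γ)) := by gcongr
            _ = _ := by ring
        · rw [indicator_of_notMem (by rw [mem_ball_zero_iff, hn]; exact h1)]
          simp
    _ = (∫⁻ r in Ioi 0, A r) * ∫⁻ θ in Ioo (-Real.pi) Real.pi, B θ := by
        rw [polarCoord_target, Measure.volume_eq_prod, ← Measure.prod_restrict,
          lintegral_prod_mul hAm.aemeasurable hBm.aemeasurable]
    _ ≤ _ := by
        refine mul_le_mul_left ((setLIntegral_le_lintegral _ _).trans_eq ?_) _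
        rw [hA, lintegral_indicator measurableSet_Ioo]

lemma measurable_toeplitzKernel {v : ℂ → ℂ} (hv : Measurable v) :
    Measurable fun p : ℂ × ℂ => toeplitzKernel v p.1 p.2 := by
  unfold toeplitzKernel kernelFun
  refine (StronglyMeasurable.integral_prod_right' (f := fun q : (ℂ × ℂ) × ℂ =>
    v q.2 * (((1 - conj q.1.2 * q.2) ^ 2)⁻¹ * conj (((1 - conj q.1.1 * q.2) ^ 2)⁻¹))) ?_).measurable
  have hconj : Measurable (conj : ℂ → ℂ) := Complex.continuous_conj.measurable
  refine Measurable.stronglyMeasurable ?_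
  refine (hv.comp measurable_snd).mul (Measurable.mul ?_ (hconj.comp ?_))
  · exact (((measurable_const.sub ((hconj.comp (measurable_snd.comp measurable_fst)).mul
      measurable_snd)).pow_const 2).inv)
  · exact (((measurable_const.sub ((hconj.comp (measurable_fst.comp measurable_fst)).mul
      measurable_snd)).pow_const 2).inv)

lemma one_sub_norm_le_norm_one_sub_conj_mul_right {a b : ℂ} (ha : ‖a‖ < 1) :
    1 - ‖b‖ ≤ ‖1 - conj a * b‖ :=
  one_sub_norm_le_norm_one_sub_mul (by simpa using ha.le)

lemma one_sub_norm_le_norm_one_sub_conj_mul_left {a b : ℂ} (hb : ‖b‖ < 1) :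
    1 - ‖a‖ ≤ ‖1 - conj a * b‖ := by
  have := one_sub_norm_le_norm_one_sub_mul (b := conj a) hb.le
  rwa [mul_comm, RCLike.norm_conj] at this

/-- The exponent 2 is split as 1/10 + 19/20 + 19/20. One part is traded for 1 - |a|, one for 1 -
|b|, leaving an integrand with γ = 19/20 < 1. -/
lemma norm_kernelFun_le_rpow {a b : ℂ} (ha : ‖a‖ < 1) (hb : ‖b‖ < 1) :
    ‖kernelFun a b‖ ≤ (1 - ‖a‖) ^ (-(1 / 10) : ℝ) *
      (‖1 - conj a * b‖ ^ (-(19 / 20) : ℝ) * (1 - ‖b‖) ^ (-(19 / 20) : ℝ)) := by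
  have h1 := one_sub_norm_le_norm_one_sub_conj_mul_right (b := b) ha
  have h2 := one_sub_norm_le_norm_one_sub_conj_mul_left (a := a) hb
  have ha' : 0 < 1 - ‖a‖ := by linarith
  have hb' : 0 < 1 - ‖b‖ := by linarith
  rw [norm_kernelFun]
  set X := ‖1 - conj a * b‖
  have hX : 0 < X := by linarith
  have e : (X ^ 2)⁻¹ = X ^ (-(1 / 10) : ℝ) * (X ^ (-(19 / 20) : ℝ) * X ^ (-(19 / 20) : ℝ)) := by
    rw [← Real.rpow_add hX, ← Real.rpow_add hX, ← Real.rpow_natCast, ← Real.rpow_neg hX.le]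
    norm_num
  rw [e]
  have e1 := Real.rpow_le_rpow_of_nonpos ha' h2 (show (-(1 / 10) : ℝ) ≤ 0 by norm_num)
  have e2 := Real.rpow_le_rpow_of_nonpos hb' h1 (show (-(19 / 20) : ℝ) ≤ 0 by norm_num)
  gcongr

lemma exists_enorm_toeplitzKernel_zero_le : ∃ C : ℝ≥0∞, C ≠ ∞ ∧ ∀ (v : ℂ → ℂ) (M : ℝ),
    (∀ w, ‖v w‖ ≤ M) → ∀ a : ℂ, ‖a‖ < 1 →
      ‖toeplitzKernel v a 0‖ₑ ≤ ENNReal.ofReal M * C *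
        ENNReal.ofReal ((1 - ‖a‖) ^ (-(1 / 10) : ℝ)) := by
  obtain ⟨C, hC, h⟩ := exists_lintegral_norm_one_sub_rpow_le (γ := 19 / 20) (by norm_num)
    (by norm_num)
  refine ⟨C, hC, fun v M hM a ha => ?_⟩
  have hM0 : 0 ≤ M := (norm_nonneg _).trans (hM 0)
  have ha' : 0 < 1 - ‖a‖ := by linarith
  calc ‖toeplitzKernel v a 0‖ₑ
      ≤ ∫⁻ η, ‖v η * (kernelFun 0 η * conj (kernelFun a η))‖ₑ ∂diskMeasure :=
        enorm_integral_le_lintegral_enorm _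
    _ ≤ ∫⁻ η, (ENNReal.ofReal M * ENNReal.ofReal ((1 - ‖a‖) ^ (-(1 / 10) : ℝ))) *
          ENNReal.ofReal (‖1 - conj a * η‖ ^ (-(19 / 20) : ℝ) * (1 - ‖η‖) ^ (-(19 / 20) : ℝ))
          ∂diskMeasure := by
        refine lintegral_mono_ae ?_
        filter_upwards [ae_norm_lt_one] with η hη
        rw [← ENNReal.ofReal_mul hM0, ← ENNReal.ofReal_mul (by positivity), ← ofReal_norm]
        refine ENNReal.ofReal_le_ofReal ?_
        rw [norm_mul, kernelFun_zero_left, one_mul, RCLike.norm_conj, mul_assoc]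
        exact mul_le_mul (hM η) (norm_kernelFun_le_rpow ha hη) (norm_nonneg _) hM0
    _ = (ENNReal.ofReal M * ENNReal.ofReal ((1 - ‖a‖) ^ (-(1 / 10) : ℝ))) *
          ∫⁻ η, ENNReal.ofReal (‖1 - conj a * η‖ ^ (-(19 / 20) : ℝ) *
            (1 - ‖η‖) ^ (-(19 / 20) : ℝ)) ∂diskMeasure :=
        lintegral_const_mul _ (by fun_prop)
    _ ≤ (ENNReal.ofReal M * ENNReal.ofReal ((1 - ‖a‖) ^ (-(1 / 10) : ℝ))) * C := by
        gcongr
        exact h a ha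
    _ = _ := by ring

/-! ### Weighted estimates for the integral kernel of a Toeplitz operator -/

/-- The weight `(1 - |w|²)^(-1/2)` for the Schur test. -/
def schurWeight (w : ℂ) : ℝ≥0∞ := ENNReal.ofReal (√(1 - ‖w‖ ^ 2))⁻¹

lemma measurable_schurWeight : Measurable schurWeight := by unfold schurWeight; fun_prop

lemma schurWeight_ne_top (w : ℂ) : schurWeight w ≠ ∞ := ENNReal.ofReal_ne_top

lemma schurWeight_ne_zero {w : ℂ} (hw : ‖w‖ < 1) : schurWeight w ≠ 0 := by
  have := one_sub_norm_sq_pos hw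
  rw [schurWeight, Ne, ENNReal.ofReal_eq_zero, not_le]
  positivity

/-- Substitute w = φ_z(a). With X = |1 - z̄a|, the Jacobian, the kernel factor and the weight
contribute X⁻⁴, X² and X, hence the remaining X⁻¹. -/
lemma lintegral_toeplitzKernel_mul_schurWeight (v : ℂ → ℂ) {z : ℂ} (hz : ‖z‖ < 1) :
    ∫⁻ w, ‖toeplitzKernel v w z‖ₑ * schurWeight w ∂diskMeasure =
      schurWeight z * ∫⁻ a, ‖toeplitzKernel (fun ζ => v (moebius z ζ)) a 0‖ₑ *
        ENNReal.ofReal (‖1 - conj z * a‖⁻¹ * (√(1 - ‖a‖ ^ 2))⁻¹) ∂diskMeasure := by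
  rw [lintegral_eq_lintegral_moebius hz, ← lintegral_const_mul' _ _ (schurWeight_ne_top z)]
  refine lintegral_congr_ae ?_
  filter_upwards [ae_norm_lt_one] with a ha
  have h := toeplitzKernel_moebius v (b := 0) hz ha (by simp)
  rw [moebius_zero_right] at h
  rw [h]
  have hZ := one_sub_norm_sq_pos hz
  have hA := one_sub_norm_sq_pos ha
  have hX : 0 < ‖1 - conj z * a‖ := norm_pos_iff.2 (one_sub_conj_mul_ne_zero hz ha)
  have hn : ‖((1 - conj z * a) * (1 - z * conj (0 : ℂ))) ^ 2 / (1 - (‖z‖ : ℂ) ^ 2) ^ 2‖ =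
      ‖1 - conj z * a‖ ^ 2 / (1 - ‖z‖ ^ 2) ^ 2 := by
    rw [norm_div, norm_pow, norm_pow, ← Complex.ofReal_one, ← Complex.ofReal_pow,
      ← Complex.ofReal_sub, Complex.norm_real, Real.norm_of_nonneg hZ.le]
    simp
  rw [enorm_mul, ← ofReal_norm, hn, schurWeight, schurWeight, one_sub_norm_moebius_sq hz ha,
    moebiusJac]
  set T := ‖toeplitzKernel (fun ζ => v (moebius z ζ)) a 0‖ₑ
  set X := ‖1 - conj z * a‖
  calc _ = ENNReal.ofReal ((1 - ‖z‖ ^ 2) ^ 2 / X ^ 4) *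
        ENNReal.ofReal (X ^ 2 / (1 - ‖z‖ ^ 2) ^ 2) *
        ENNReal.ofReal (√((1 - ‖z‖ ^ 2) * (1 - ‖a‖ ^ 2) / X ^ 2))⁻¹ * T := by ring
    _ = ENNReal.ofReal (√(1 - ‖z‖ ^ 2))⁻¹ * ENNReal.ofReal (X⁻¹ * (√(1 - ‖a‖ ^ 2))⁻¹) * T := by
        congr 1
        rw [← ENNReal.ofReal_mul (by positivity), ← ENNReal.ofReal_mul (by positivity),
          ← ENNReal.ofReal_mul (by positivity), Real.sqrt_div (by positivity),
          Real.sqrt_mul hZ.le, Real.sqrt_sq hX.le]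
        congr 1
        field_simp
    _ = _ := by ring

/-- Here 6/5 is the exponent conjugate to 6. Of X^(-6/5), the part X^(-3/10) is absorbed into (1 -
|a|)^(-3/10), so both exponents become 9/10 < 1. -/
lemma exists_lintegral_weight_rpow_le : ∃ C : ℝ≥0∞, C ≠ ∞ ∧ ∀ z : ℂ, ‖z‖ < 1 →
    ∫⁻ a, ENNReal.ofReal (‖1 - conj z * a‖⁻¹ * (√(1 - ‖a‖ ^ 2))⁻¹) ^ (6 / 5 : ℝ) ∂diskMeasure
      ≤ C := by
  obtain ⟨C, hC, h⟩ := exists_lintegral_norm_one_sub_rpow_le (γ := 9 / 10) (by norm_num)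
    (by norm_num)
  refine ⟨C, hC, fun z hz => (lintegral_mono_ae ?_).trans (h z hz)⟩
  filter_upwards [ae_norm_lt_one] with a ha
  have h1 := one_sub_norm_le_norm_one_sub_conj_mul_right (b := a) hz
  have ha' : 0 < 1 - ‖a‖ := by linarith
  set X := ‖1 - conj z * a‖
  have hX : 0 < X := by linarith
  have hA := one_sub_norm_sq_pos ha
  rw [ENNReal.ofReal_rpow_of_nonneg (by positivity) (by norm_num)]
  refine ENNReal.ofReal_le_ofReal ?_
  have e1 : X⁻¹ ^ (6 / 5 : ℝ) = X ^ (-(9 / 10) : ℝ) * X ^ (-(3 / 10) : ℝ) := by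
    rw [← Real.rpow_add hX, Real.inv_rpow hX.le, ← Real.rpow_neg hX.le]
    norm_num
  have e2 : (√(1 - ‖a‖ ^ 2))⁻¹ ^ (6 / 5 : ℝ) = (1 - ‖a‖ ^ 2) ^ (-(3 / 5) : ℝ) := by
    rw [Real.sqrt_eq_rpow, Real.inv_rpow (by positivity), ← Real.rpow_mul hA.le,
      ← Real.rpow_neg hA.le]
    norm_num
  have e3 : (1 - ‖a‖ ^ 2) ^ (-(3 / 5) : ℝ) ≤ (1 - ‖a‖) ^ (-(3 / 5) : ℝ) :=
    Real.rpow_le_rpow_of_nonpos ha' (by nlinarith [norm_nonneg a]) (by norm_num)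
  have e4 : X ^ (-(3 / 10) : ℝ) ≤ (1 - ‖a‖) ^ (-(3 / 10) : ℝ) :=
    Real.rpow_le_rpow_of_nonpos ha' h1 (by norm_num)
  have e5 : (1 - ‖a‖) ^ (-(9 / 10) : ℝ) =
      (1 - ‖a‖) ^ (-(3 / 10) : ℝ) * (1 - ‖a‖) ^ (-(3 / 5) : ℝ) := by
    rw [← Real.rpow_add ha']
    norm_num
  rw [Real.mul_rpow (by positivity) (by positivity), e1, e2, e5, mul_assoc]
  gcongr

/-- The `L⁶` norm of `T_{v ∘ φ_z} 1`. -/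
def translateNorm (v : ℂ → ℂ) (z : ℂ) : ℝ≥0∞ :=
  (∫⁻ a, ‖toeplitzKernel (fun ζ => v (moebius z ζ)) a 0‖ₑ ^ (6 : ℝ) ∂diskMeasure) ^ (1 / 6 : ℝ)

lemma measurable_toeplitzKernel_left {v : ℂ → ℂ} (hv : Measurable v) (z : ℂ) :
    Measurable fun w : ℂ => toeplitzKernel v w z :=
  Measurable.comp (g := fun p : ℂ × ℂ => toeplitzKernel v p.1 p.2) (f := fun w => (w, z))
    (measurable_toeplitzKernel hv) measurable_prodMk_right

lemma measurable_toeplitzKernel_translate {v : ℂ → ℂ} (hv : Measurable v) (z : ℂ) :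
    Measurable fun a : ℂ => toeplitzKernel (fun ζ => v (moebius z ζ)) a 0 :=
  measurable_toeplitzKernel_left (hv.comp (measurable_moebius z)) 0

lemma exists_lintegral_toeplitzKernel_mul_schurWeight_le : ∃ C : ℝ≥0∞, C ≠ ∞ ∧
    ∀ v : ℂ → ℂ, Measurable v → ∀ z : ℂ, ‖z‖ < 1 →
      ∫⁻ w, ‖toeplitzKernel v w z‖ₑ * schurWeight w ∂diskMeasure ≤
        C * translateNorm v z * schurWeight z := by
  obtain ⟨C, hC, h⟩ := exists_lintegral_weight_rpow_le
  refine ⟨C ^ (1 / (6 / 5) : ℝ), ENNReal.rpow_ne_top_of_nonneg (by norm_num) hC,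
    fun v hv z hz => ?_⟩
  rw [lintegral_toeplitzKernel_mul_schurWeight v hz, mul_comm]
  gcongr
  have hpq : (6 : ℝ).HolderConjugate (6 / 5) := by
    rw [Real.holderConjugate_iff]; norm_num
  refine (ENNReal.lintegral_mul_le_Lp_mul_Lq diskMeasure hpq
    (measurable_toeplitzKernel_translate hv z).enorm.aemeasurable
    (by fun_prop)).trans ?_
  rw [mul_comm, translateNorm]
  gcongr
  exact h z hz

/-- The sixth power turns the growth exponent 1/10 into 6/10 < 1, giving an integrable majorant
independent of z. -/
lemma exists_translate_rpow_le {M : ℝ} : ∃ D : ℝ≥0∞, D ≠ ∞ ∧ ∀ v : ℂ → ℂ,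
    (∀ w, ‖v w‖ ≤ M) → ∀ z a : ℂ, ‖a‖ < 1 →
      ‖toeplitzKernel (fun ζ => v (moebius z ζ)) a 0‖ₑ ^ (6 : ℝ) ≤
        D * ENNReal.ofReal ((1 - ‖a‖) ^ (-(6 / 10) : ℝ)) := by
  obtain ⟨C, hC, h⟩ := exists_enorm_toeplitzKernel_zero_le
  refine ⟨(ENNReal.ofReal M * C) ^ (6 : ℝ), ENNReal.rpow_ne_top_of_nonneg (by norm_num)
    (ENNReal.mul_ne_top ENNReal.ofReal_ne_top hC), fun v hM z a ha => ?_⟩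
  have ha' : 0 < 1 - ‖a‖ := by linarith
  have h1 := h (fun ζ => v (moebius z ζ)) M (fun w => hM _) a ha
  refine (ENNReal.rpow_le_rpow h1 (by norm_num : (0 : ℝ) ≤ 6)).trans_eq ?_
  rw [ENNReal.mul_rpow_of_nonneg _ _ (by norm_num),
    ENNReal.ofReal_rpow_of_nonneg (by positivity) (by norm_num), ← Real.rpow_mul ha'.le]
  norm_num

lemma lintegral_one_sub_norm_rpow_ne_top :
    ∫⁻ a : ℂ, ENNReal.ofReal ((1 - ‖a‖) ^ (-(6 / 10) : ℝ)) ∂diskMeasure ≠ ∞ := by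
  obtain ⟨C, hC, h⟩ := exists_lintegral_norm_one_sub_rpow_le (γ := 6 / 10) (by norm_num)
    (by norm_num)
  refine ne_top_of_le_ne_top hC ?_
  simpa using h 0 (by simp)

lemma exists_translateNorm_le (M : ℝ) : ∃ D : ℝ≥0∞, D ≠ ∞ ∧ ∀ v : ℂ → ℂ,
    (∀ w, ‖v w‖ ≤ M) → ∀ z : ℂ, translateNorm v z ≤ D := by
  obtain ⟨D, hD, h⟩ := exists_translate_rpow_le (M := M)
  refine ⟨(∫⁻ a : ℂ, D * ENNReal.ofReal ((1 - ‖a‖) ^ (-(6 / 10) : ℝ)) ∂diskMeasure) ^ (1 / 6 : ℝ),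
    ENNReal.rpow_ne_top_of_nonneg (by norm_num) ?_, fun v hv z => ?_⟩
  · rw [lintegral_const_mul' _ _ hD]
    exact ENNReal.mul_ne_top hD lintegral_one_sub_norm_rpow_ne_top
  · refine ENNReal.rpow_le_rpow (lintegral_mono_ae ?_) (by norm_num)
    filter_upwards [ae_norm_lt_one] with a ha using h v hv z a ha

lemma tendsto_translateNorm {u : Lp ℂ ∞ diskMeasure} {v : ℂ → ℂ}
    (huv : u =ᵐ[diskMeasure] v) (hv : Measurable v) {M : ℝ} (hM : ∀ w, ‖v w‖ ≤ M)
    (h : Tendsto (berezinSymbol u) toBoundary (𝓝 0)) :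
    Tendsto (fun z : 𝔻 => translateNorm v z) toBoundary (𝓝 0) := by
  obtain ⟨D, hD, hle⟩ := exists_translate_rpow_le (M := M)
  have h1 : Tendsto (fun z : 𝔻 => ∫⁻ a, ‖toeplitzKernel (fun ζ => v (moebius z ζ)) a 0‖ₑ ^ (6 : ℝ)
      ∂diskMeasure) toBoundary (𝓝 (∫⁻ _, 0 ∂diskMeasure)) := by
    refine tendsto_lintegral_filter_of_dominated_convergence
      (fun a => D * ENNReal.ofReal ((1 - ‖a‖) ^ (-(6 / 10) : ℝ))) ?_ ?_ ?_ ?_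
    · exact Eventually.of_forall fun z =>
        (measurable_toeplitzKernel_translate hv z).enorm.pow_const _
    · refine Eventually.of_forall fun z => ?_
      filter_upwards [ae_norm_lt_one] with a ha using hle v hM z a ha
    · rw [lintegral_const_mul' _ _ hD]
      exact ENNReal.mul_ne_top hD lintegral_one_sub_norm_rpow_ne_top
    · filter_upwards [ae_norm_lt_one] with a ha
      have h2 := (tendsto_toeplitzKernel_zero huv hv hM h ha).enorm
      have h3 := (ENNReal.continuous_rpow_const (y := (6 : ℝ))).tendsto 0 |>.comp
        (by simpa using h2)
      simpa [Function.comp_def] using h3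
  have h4 := (ENNReal.continuous_rpow_const (y := (1 / 6 : ℝ))).tendsto _ |>.comp h1
  simpa [Function.comp_def, translateNorm] using h4

lemma toeplitzKernel_conj_symm (v : ℂ → ℂ) (w z : ℂ) :
    toeplitzKernel (fun ζ => conj (v ζ)) z w = conj (toeplitzKernel v w z) := by
  rw [toeplitzKernel, toeplitzKernel, ← integral_conj]
  refine integral_congr_ae (Eventually.of_forall fun ζ => ?_)
  simp only [map_mul, Complex.conj_conj]
  ring

/-- The adjoint of a Toeplitz operator has the conjugate symbol, so this is the estimate over the
other variable applied to conj v. -/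
lemma exists_lintegral_toeplitzKernel_right_le {v : ℂ → ℂ} (hv : Measurable v) {M : ℝ}
    (hM : ∀ w, ‖v w‖ ≤ M) : ∃ C : ℝ≥0∞, C ≠ ∞ ∧ ∀ w : ℂ, ‖w‖ < 1 →
      ∫⁻ z, ‖toeplitzKernel v w z‖ₑ * schurWeight z ∂diskMeasure ≤ C * schurWeight w := by
  obtain ⟨C, hC, h⟩ := exists_lintegral_toeplitzKernel_mul_schurWeight_le
  obtain ⟨D, hD, h'⟩ := exists_translateNorm_le M
  refine ⟨C * D, ENNReal.mul_ne_top hC hD, fun w hw => ?_⟩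
  have h1 := h (fun ζ => conj (v ζ)) (Complex.continuous_conj.measurable.comp hv) w hw
  simp only [toeplitzKernel_conj_symm, RCLike.enorm_conj] at h1
  refine h1.trans ?_
  gcongr
  exact h' _ (fun w => by simpa using hM w) w

/-! ### The Schur test -/

lemma lintegral_mul_sq_le {α : Type*} [MeasurableSpace α] {μ : Measure α} {f g : α → ℝ≥0∞}
    (hf : AEMeasurable f μ) (hg : AEMeasurable g μ) :
    (∫⁻ x, f x * g x ∂μ) ^ 2 ≤ (∫⁻ x, f x ^ (2 : ℝ) ∂μ) * ∫⁻ x, g x ^ (2 : ℝ) ∂μ := by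
  have h := ENNReal.lintegral_mul_le_Lp_mul_Lq μ Real.HolderConjugate.two_two hf hg
  have h2 := pow_le_pow_left' h 2
  refine h2.trans_eq ?_
  rw [mul_pow, ← ENNReal.rpow_natCast, ← ENNReal.rpow_natCast, ← ENNReal.rpow_mul,
    ← ENNReal.rpow_mul]
  norm_num

/-- Cauchy–Schwarz on the splitting k F = (k p)^(1/2) · (k p⁻¹)^(1/2) F, then Tonelli. The column
bound B is needed only where F ≠ 0, so a cut-off F can exploit a small B near the boundary. -/
lemma lintegral_sq_le_of_schur {α : Type*} [MeasurableSpace α] {μ : Measure α} [SFinite μ]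
    {k : α → α → ℝ≥0∞} {p F : α → ℝ≥0∞} {A B : ℝ≥0∞}
    (hk : Measurable (Function.uncurry k)) (hp : Measurable p) (hF : Measurable F)
    (hp0 : ∀ᵐ x ∂μ, p x ≠ 0) (hpt : ∀ x, p x ≠ ∞)
    (hA : ∀ᵐ w ∂μ, ∫⁻ z, k w z * p z ∂μ ≤ A * p w)
    (hB : ∀ᵐ z ∂μ, F z = 0 ∨ ∫⁻ w, k w z * p w ∂μ ≤ B * p z) :
    ∫⁻ w, (∫⁻ z, k w z * F z ∂μ) ^ 2 ∂μ ≤ A * B * ∫⁻ z, F z ^ 2 ∂μ := by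
  have hk1 : ∀ w, Measurable (k w) := fun w => hk.of_uncurry_left
  have hk2 : ∀ z, Measurable fun w => k w z := fun z => hk.of_uncurry_right
  have hcs : ∀ᵐ w ∂μ, (∫⁻ z, k w z * F z ∂μ) ^ 2 ≤
      A * ∫⁻ z, p w * (k w z * ((p z)⁻¹ * F z ^ 2)) ∂μ := by
    filter_upwards [hA] with w hw
    have e1 : ∫⁻ z, k w z * F z ∂μ =
        ∫⁻ z, (k w z * p z) ^ (1 / 2 : ℝ) * ((k w z * (p z)⁻¹) ^ (1 / 2 : ℝ) * F z) ∂μ := by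
      refine lintegral_congr_ae ?_
      filter_upwards [hp0] with z hz
      have e3 : (k w z * p z) * (k w z * (p z)⁻¹) = k w z ^ (2 : ℝ) := by
        rw [mul_mul_mul_comm, ENNReal.mul_inv_cancel hz (hpt z), mul_one, ← sq]
        norm_num
      rw [← mul_assoc, ← ENNReal.mul_rpow_of_nonneg _ _ (by norm_num), e3, ← ENNReal.rpow_mul]
      norm_num
    rw [e1]
    refine (lintegral_mul_sq_le (by fun_prop) (by fun_prop)).trans ?_
    have e4 : ∀ z, ((k w z * p z) ^ (1 / 2 : ℝ)) ^ (2 : ℝ) = k w z * p z := by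
      intro z
      rw [← ENNReal.rpow_mul]
      norm_num
    have e5 : ∀ z, ((k w z * (p z)⁻¹) ^ (1 / 2 : ℝ) * F z) ^ (2 : ℝ) =
        k w z * ((p z)⁻¹ * F z ^ 2) := by
      intro z
      rw [ENNReal.mul_rpow_of_nonneg _ _ (by norm_num), ← ENNReal.rpow_mul]
      norm_num
      ring
    simp_rw [e4, e5]
    rw [lintegral_const_mul' _ _ (hpt w), ← mul_assoc]
    gcongr
  have hm : Measurable (Function.uncurry fun w z => p w * (k w z * ((p z)⁻¹ * F z ^ 2))) := by
    exact (hp.comp measurable_fst).mul (hk.mul (((hp.comp measurable_snd).inv).mul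
      ((hF.comp measurable_snd).pow_const 2)))
  calc _ ≤ ∫⁻ w, A * ∫⁻ z, p w * (k w z * ((p z)⁻¹ * F z ^ 2)) ∂μ ∂μ := lintegral_mono_ae hcs
    _ = A * ∫⁻ z, ∫⁻ w, p w * (k w z * ((p z)⁻¹ * F z ^ 2)) ∂μ ∂μ := by
        rw [lintegral_const_mul _ hm.lintegral_prod_right, lintegral_lintegral_swap hm.aemeasurable]
    _ ≤ A * ∫⁻ z, B * F z ^ 2 ∂μ := by
        refine mul_le_mul_right (lintegral_mono_ae ?_) A
        filter_upwards [hB, hp0] with z hz hz0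
        rcases hz with hz | hz
        · simp [hz]
        · calc ∫⁻ w, p w * (k w z * ((p z)⁻¹ * F z ^ 2)) ∂μ
              = ∫⁻ w, (k w z * p w) * ((p z)⁻¹ * F z ^ 2) ∂μ := by
                congr 1; ext w; ring
            _ = (∫⁻ w, k w z * p w ∂μ) * ((p z)⁻¹ * F z ^ 2) := by
                exact lintegral_mul_const _ ((hk2 z).mul hp)
            _ ≤ (B * p z) * ((p z)⁻¹ * F z ^ 2) := by gcongr
            _ = B * (p z * (p z)⁻¹) * F z ^ 2 := by ring
            _ = B * F z ^ 2 := by rw [ENNReal.mul_inv_cancel hz0 (hpt z), mul_one]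
    _ = A * B * ∫⁻ z, F z ^ 2 ∂μ := by
        rw [lintegral_const_mul _ (hF.pow_const 2), mul_assoc]

/-! ### Cutting off near the boundary -/

/-- The Toeplitz operator whose symbol is the indicator function of the disk of radius `r`. -/
def cutoff (r : ℝ) : bergmanSpace →L[ℂ] bergmanSpace :=
  toeplitz (indicatorConstLp ∞ (measurableSet_closedBall (x := (0 : ℂ)) (ε := r))
    (measure_ne_top diskMeasure _) 1)

lemma bergmanSpace.coe_ae_eq_of_apply {f : bergmanSpace} {g : ℂ → ℂ}
    (h : ∀ z : 𝔻, f z = g z) : (f : Lp ℂ 2 diskMeasure) =ᵐ[diskMeasure] g := by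
  filter_upwards [coe_ae_eq_rep f, ae_norm_lt_one] with z h1 hz
  rw [h1]
  lift z to 𝔻 using hz
  rw [← h z]
  exact (apply_eq (differentiableOn_rep f) (coe_ae_eq_rep f) z).symm

/-- Evaluation of T_u g at w is pairing g with T_u* K_w, the conjugate of the integral kernel. That
function is analytic, so the projection inside `cutoff` drops out of the pairing and only the
indicator remains. -/
lemma toeplitz_sub_cutoff_apply {u : Lp ℂ ∞ diskMeasure} {v : ℂ → ℂ}
    (huv : u =ᵐ[diskMeasure] v) (r : ℝ) (f : bergmanSpace) (w : 𝔻) :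
    toeplitz u (f - cutoff r f) w = ∫ z, toeplitzKernel v w z *
      (closedBall (0 : ℂ) r)ᶜ.indicator (f : Lp ℂ 2 diskMeasure) z ∂diskMeasure := by
  set h : bergmanSpace := (toeplitz u).adjoint (bergmanKernel w) with hh
  have hval : (h : Lp ℂ 2 diskMeasure) =ᵐ[diskMeasure] fun z => conj (toeplitzKernel v w z) := by
    refine bergmanSpace.coe_ae_eq_of_apply fun z => ?_
    rw [← inner_bergmanKernel, hh, ContinuousLinearMap.adjoint_inner_right, ← inner_conj_symm,
      inner_bergmanKernel, toeplitz_bergmanKernel_apply huv]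
  have hint : Integrable (fun z => (f : Lp ℂ 2 diskMeasure) z *
      conj ((h : Lp ℂ 2 diskMeasure) z)) diskMeasure := by
    simpa [RCLike.inner_apply] using
      L2.integrable_inner (𝕜 := ℂ) (h : Lp ℂ 2 diskMeasure) (f : Lp ℂ 2 diskMeasure)
  rw [← inner_bergmanKernel, ← ContinuousLinearMap.adjoint_inner_left, ← hh, inner_sub_right,
    cutoff, inner_toeplitz, Submodule.coe_inner, L2.inner_def]
  simp only [RCLike.inner_apply]
  rw [← integral_sub hint]
  · refine integral_congr_ae ?_
    filter_upwards [hval, indicatorConstLp_coeFn (p := ∞) (μ := diskMeasure)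
      (hs := measurableSet_closedBall (x := (0 : ℂ)) (ε := r))
      (hμs := measure_ne_top diskMeasure _) (c := (1 : ℂ))] with z h1 h2
    rw [h2, h1]
    by_cases hz : z ∈ closedBall (0 : ℂ) r
    · simp [hz]
    · simp [hz, mul_comm]
  · refine hint.bdd_mul (c := 1) (Lp.aestronglyMeasurable _) ?_
    filter_upwards [indicatorConstLp_coeFn (p := ∞) (μ := diskMeasure)
      (hs := measurableSet_closedBall (x := (0 : ℂ)) (ε := r))
      (hμs := measure_ne_top diskMeasure _) (c := (1 : ℂ))] with z h2
    rw [h2]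
    exact norm_indicator_le_norm_self (fun _ => (1 : ℂ)) z |>.trans (by simp)

lemma enorm_sq_eq_lintegral (f : Lp ℂ 2 diskMeasure) :
    ‖f‖ₑ ^ 2 = ∫⁻ z, ‖f z‖ₑ ^ 2 ∂diskMeasure := by
  have := eLpNorm_nnreal_pow_eq_lintegral (f := f) (μ := diskMeasure) (p := 2) two_ne_zero
  rw [Lp.enorm_def]
  simpa using this

lemma enorm_toeplitz_sub_cutoff_sq_le {u : Lp ℂ ∞ diskMeasure} {v : ℂ → ℂ}
    (huv : u =ᵐ[diskMeasure] v) (hv : Measurable v) {r : ℝ} {A B : ℝ≥0∞}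
    (hA : ∀ w : ℂ, ‖w‖ < 1 →
      ∫⁻ z, ‖toeplitzKernel v w z‖ₑ * schurWeight z ∂diskMeasure ≤ A * schurWeight w)
    (hB : ∀ z : ℂ, ‖z‖ < 1 → r < ‖z‖ →
      ∫⁻ w, ‖toeplitzKernel v w z‖ₑ * schurWeight w ∂diskMeasure ≤ B * schurWeight z)
    (f : bergmanSpace) : ‖toeplitz u (f - cutoff r f)‖ₑ ^ 2 ≤ A * B * ‖f‖ₑ ^ 2 := by
  have hfm : Measurable (f : Lp ℂ 2 diskMeasure) := (Lp.stronglyMeasurable _).measurable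
  have hcm : MeasurableSet (closedBall (0 : ℂ) r)ᶜ := measurableSet_closedBall.compl
  set F : ℂ → ℝ≥0∞ := fun z => ‖(closedBall (0 : ℂ) r)ᶜ.indicator (f : Lp ℂ 2 diskMeasure) z‖ₑ
    with hFdef
  have hF : Measurable F := (hfm.indicator hcm).enorm
  have hae : (toeplitz u (f - cutoff r f) : Lp ℂ 2 diskMeasure) =ᵐ[diskMeasure] fun w =>
      ∫ z, toeplitzKernel v w z *
        (closedBall (0 : ℂ) r)ᶜ.indicator (f : Lp ℂ 2 diskMeasure) z ∂diskMeasure :=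
    bergmanSpace.coe_ae_eq_of_apply fun w => toeplitz_sub_cutoff_apply huv r f w
  have hco : ∀ g : bergmanSpace, ‖g‖ₑ = ‖(g : Lp ℂ 2 diskMeasure)‖ₑ := fun _ => rfl
  rw [hco, hco, enorm_sq_eq_lintegral, enorm_sq_eq_lintegral]
  calc _ ≤ ∫⁻ w, (∫⁻ z, ‖toeplitzKernel v w z‖ₑ * F z ∂diskMeasure) ^ 2 ∂diskMeasure := by
        refine lintegral_mono_ae ?_
        filter_upwards [hae] with w hw
        rw [hw]
        gcongr
        refine (enorm_integral_le_lintegral_enorm _).trans_eq ?_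
        simp_rw [enorm_mul]
        rfl
    _ ≤ A * B * ∫⁻ z, F z ^ 2 ∂diskMeasure := by
        refine lintegral_sq_le_of_schur (p := schurWeight) (measurable_toeplitzKernel hv).enorm
          measurable_schurWeight hF ?_ schurWeight_ne_top ?_ ?_
        · filter_upwards [ae_norm_lt_one] with w hw using schurWeight_ne_zero hw
        · filter_upwards [ae_norm_lt_one] with w hw using hA w hw
        · filter_upwards [ae_norm_lt_one] with z hz
          by_cases h : r < ‖z‖
          · exact Or.inr (hB z hz h)
          · left
            simp only [hFdef]
            rw [indicator_of_notMem (by simpa using h), enorm_zero]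
    _ ≤ _ := by
        gcongr with z
        exact enorm_indicator_le_enorm_self _ _

/-! ### Compactness of the cut-off operators -/

/-- By the reproducing property, the squared norm of a difference of kernels is a combination of
kernel values. Continuity makes the kernels with |z| ≤ r a compact set. -/
lemma continuous_bergmanKernel : Continuous bergmanKernel := by
  rw [continuous_iff_continuousAt]
  intro z
  rw [ContinuousAt, tendsto_iff_norm_sub_tendsto_zero]
  have hsq : ∀ w : 𝔻, ‖bergmanKernel w - bergmanKernel z‖ ^ 2 =
      (kernelFun w w).re - 2 * (kernelFun z w).re + (kernelFun z z).re := by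
    intro w
    rw [norm_sub_sq (𝕜 := ℂ), ← inner_self_eq_norm_sq (𝕜 := ℂ) (bergmanKernel w),
      ← inner_self_eq_norm_sq (𝕜 := ℂ) (bergmanKernel z)]
    simp only [inner_bergmanKernel, bergmanKernel_apply]
    rfl
  have hc1 : Continuous fun w : 𝔻 => kernelFun w w := by
    unfold kernelFun
    refine Continuous.inv₀ (by fun_prop) fun w =>
      pow_ne_zero _ (one_sub_conj_mul_ne_zero w.norm_lt_one w.norm_lt_one)
  have hc2 : Continuous fun w : 𝔻 => kernelFun z w := by
    unfold kernelFun
    refine Continuous.inv₀ (by fun_prop) fun w =>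
      pow_ne_zero _ (one_sub_conj_mul_ne_zero z.norm_lt_one w.norm_lt_one)
  have h : Tendsto (fun w : 𝔻 => ‖bergmanKernel w - bergmanKernel z‖ ^ 2) (𝓝 z) (𝓝 0) := by
    simp_rw [hsq]
    have hc : Continuous fun w : 𝔻 =>
        (kernelFun w w).re - 2 * (kernelFun z w).re + (kernelFun z z).re := by
      have := Complex.continuous_re.comp hc1
      have := Complex.continuous_re.comp hc2
      fun_prop
    have := hc.tendsto z
    convert this using 2
    ring
  have h2 := h.sqrt
  simpa using h2

lemma isCompact_norm_le {r : ℝ} (hr : r < 1) : IsCompact {z : 𝔻 | ‖(z : ℂ)‖ ≤ r} := by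
  rw [Complex.UnitDisc.isEmbedding_coe.isCompact_iff]
  convert isCompact_closedBall (0 : ℂ) r using 1
  ext w
  simp only [mem_image, mem_ofPred_eq, mem_closedBall_zero_iff]
  exact ⟨fun ⟨z, hz, h⟩ => h ▸ hz, fun hw => ⟨Complex.UnitDisc.mk w (hw.trans_lt hr), hw, rfl⟩⟩

lemma norm_cutoff_le {r δ : ℝ} (hδ : 0 ≤ δ) {g : bergmanSpace}
    (hg : ∀ z : 𝔻, ‖(z : ℂ)‖ ≤ r → ‖g z‖ ≤ δ) : ‖cutoff r g‖ ≤ δ := by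
  rw [cutoff, toeplitz, ContinuousLinearMap.comp_apply]
  refine (Submodule.norm_orthogonalProjectionOnto_apply_le _ _).trans ?_
  rw [ContinuousLinearMap.comp_apply]
  set χ := indicatorConstLp ∞ (measurableSet_closedBall (x := (0 : ℂ)) (ε := r))
    (measure_ne_top diskMeasure _) (1 : ℂ)
  refine (Lp.norm_le_of_ae_bound hδ ?_).trans_eq (by simp [measureUnivNNReal])
  filter_upwards [(ContinuousLinearMap.mul ℂ ℂ).coeFn_holder (r := 2) χ
    (g : Lp ℂ 2 diskMeasure), bergmanSpace.coe_ae_eq_rep g, ae_norm_lt_one,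
    indicatorConstLp_coeFn (p := ∞) (μ := diskMeasure)
      (hs := measurableSet_closedBall (x := (0 : ℂ)) (ε := r))
      (hμs := measure_ne_top diskMeasure _) (c := (1 : ℂ))] with z h1 h2 hz h3
  rw [show mulOp χ (bergmanSpace.subtypeL g) =
    (ContinuousLinearMap.mul ℂ ℂ).holder 2 χ (g : Lp ℂ 2 diskMeasure) from rfl, h1, h2, h3]
  by_cases h : z ∈ closedBall (0 : ℂ) r
  · have := hg (Complex.UnitDisc.mk z hz) (by simpa using h)
    rw [bergmanSpace.apply_eq (bergmanSpace.differentiableOn_rep g)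
      (bergmanSpace.coe_ae_eq_rep g)] at this
    simpa [h] using this
  · simpa [h] using hδ

lemma isCompactOperator_of_forall_norm_sub_le {E : Type*} [NormedAddCommGroup E]
    [NormedSpace ℂ E] [CompleteSpace E] {T : E →L[ℂ] E}
    (h : ∀ ε > 0, ∃ S : E →L[ℂ] E, IsCompactOperator S ∧ ‖T - S‖ ≤ ε) :
    IsCompactOperator T := by
  have hcl : IsClosed {S : E →L[ℂ] E | IsCompactOperator S} :=
    isClosed_setOfPred_isCompactOperator
  refine hcl.closure_subset (Metric.mem_closure_iff.2 fun ε hε => ?_)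
  obtain ⟨S, hS, hn⟩ := h (ε / 2) (by positivity)
  exact ⟨S, hS, by rw [dist_eq_norm]; linarith⟩

/-- Project onto the span of a finite ε-net of the kernels K_z, |z| ≤ r. What is left of f is at
most ε ‖f‖ on that disk, the only place the cut-off symbol sees. -/
lemma isCompactOperator_cutoff {r : ℝ} (hr : r < 1) : IsCompactOperator (cutoff r) := by
  refine isCompactOperator_of_forall_norm_sub_le fun ε hε => ?_
  obtain ⟨t, -, htf, hcov⟩ :=
    ((isCompact_norm_le hr).image continuous_bergmanKernel).finite_cover_balls hε
  set V : Submodule ℂ bergmanSpace := Submodule.span ℂ t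
  have : FiniteDimensional ℂ V := FiniteDimensional.span_of_finite ℂ htf
  have hP : IsCompactOperator V.starProjection :=
    (isCompactOperator_of_locallyCompactSpace_dom (V.orthogonalProjectionOnto)).clm_comp V.subtypeL
  refine ⟨cutoff r ∘L V.starProjection, hP.clm_comp (cutoff r), ?_⟩
  refine ContinuousLinearMap.opNorm_le_bound _ hε.le fun f => ?_
  rw [sub_apply, ContinuousLinearMap.comp_apply, ← map_sub]
  refine norm_cutoff_le (by positivity) fun z hz => ?_
  obtain ⟨k, hk, hkz⟩ := mem_iUnion₂.1 (hcov ⟨z, hz, rfl⟩)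
  have hort := V.sub_starProjection_mem_orthogonal f
  have h0 : inner ℂ k (f - V.starProjection f) = 0 :=
    (Submodule.mem_orthogonal V _).1 hort k (Submodule.subset_span hk)
  have hn : ‖f - V.starProjection f‖ ≤ ‖f‖ := by
    rw [← Submodule.starProjection_orthogonal_val]
    exact Submodule.norm_starProjection_apply_le _ _
  -- The remainder is orthogonal to the net point k, so K_z may be replaced by K_z - k, of norm less
  -- than ε.
  rw [← inner_bergmanKernel, ← sub_zero (inner ℂ _ _), ← h0,
    ← inner_sub_left (𝕜 := ℂ) (E := bergmanSpace)]
  refine (norm_inner_le_norm _ _).trans ?_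
  rw [mem_ball, dist_eq_norm] at hkz
  gcongr

/-! ### Weak convergence of the normalized kernels -/

/-- Against a fixed kernel the decay is explicit. The span of the kernels is dense, since a function
orthogonal to all of them vanishes at every point, and `‖k_z‖ = 1` extends the limit to every y. -/
lemma tendsto_inner_normalizedKernel (y : bergmanSpace) :
    Tendsto (fun z => inner ℂ (normalizedKernel z) y) toBoundary (𝓝 0) := by
  have hval : ∀ (z : 𝔻) (y : bergmanSpace), inner ℂ (normalizedKernel z) y =
      (1 - (‖(z : ℂ)‖ : ℂ) ^ 2) * y z := by
    intro z y
    rw [normalizedKernel_eq, inner_smul_left (𝕜 := ℂ) (E := bergmanSpace), inner_bergmanKernel]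
    simp
  have h0 : Tendsto (fun z : 𝔻 => (1 - (‖(z : ℂ)‖ : ℂ) ^ 2)) toBoundary (𝓝 0) := by
    have := ((Complex.continuous_ofReal.tendsto 1).comp tendsto_norm_toBoundary).pow 2
      |>.const_sub 1
    simpa using this
  have hK : ∀ w : 𝔻, Tendsto (fun z => inner ℂ (normalizedKernel z) (bergmanKernel w))
      toBoundary (𝓝 0) := by
    intro w
    refine squeeze_zero_norm (a := fun z : 𝔻 => ‖(1 - (‖(z : ℂ)‖ : ℂ) ^ 2)‖ *
      ((1 - ‖(w : ℂ)‖) ^ 2)⁻¹) (fun z => ?_) ?_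
    · rw [hval, norm_mul, bergmanKernel_apply]
      gcongr
      exact norm_kernelFun_le w.norm_lt_one z.norm_lt_one.le
    · simpa using h0.norm.mul_const ((1 - ‖(w : ℂ)‖) ^ 2)⁻¹
  have hspan : ∀ x ∈ Submodule.span ℂ (range bergmanKernel),
      Tendsto (fun z => inner ℂ (normalizedKernel z) x) toBoundary (𝓝 0) := by
    intro x hx
    induction hx using Submodule.span_induction with
    | mem x hx => obtain ⟨w, rfl⟩ := hx; exact hK w
    | zero => simpa using tendsto_const_nhds
    | add x y _ _ hx hy => simpa [inner_add_right] using hx.add hy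
    | smul c x _ hx => simpa [hval, RKHS.coe_smul, mul_left_comm] using hx.const_mul c
  have hdense : Dense (Submodule.span ℂ (range bergmanKernel) : Set bergmanSpace) := by
    rw [Submodule.dense_iff_topologicalClosure_eq_top, Submodule.topologicalClosure_eq_top_iff,
      Submodule.eq_bot_iff]
    intro x hx
    refine RKHS.ext fun w => ?_
    rw [← inner_bergmanKernel, (Submodule.mem_orthogonal _ _).1 hx _
      (Submodule.subset_span ⟨w, rfl⟩), RKHS.coe_zero]
    rfl
  rw [Metric.tendsto_nhds]
  intro ε hε
  obtain ⟨x, hx, hxy⟩ := Metric.mem_closure_iff.1 (hdense y) (ε / 2) (by positivity)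
  filter_upwards [Metric.tendsto_nhds.1 (hspan x hx) (ε / 2) (by positivity)] with z hz
  rw [dist_zero_right] at hz ⊢
  have h1 : inner ℂ (normalizedKernel z) y =
      inner ℂ (normalizedKernel z) (y - x) + inner ℂ (normalizedKernel z) x := by
    rw [← inner_add_right (𝕜 := ℂ) (E := bergmanSpace), sub_add_cancel]
  have h2 := norm_inner_le_norm (𝕜 := ℂ) (normalizedKernel z) (y - x)
  rw [norm_normalizedKernel, one_mul, ← dist_eq_norm] at h2
  rw [h1]
  linarith [norm_add_le (inner ℂ (normalizedKernel z) (y - x)) (inner ℂ (normalizedKernel z) x)]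

/-- The Berezin transform of a compact operator vanishes at the boundary. -/
lemma IsCompactOperator.tendsto_berezin {S : bergmanSpace →L[ℂ] bergmanSpace}
    (hS : IsCompactOperator S) : Tendsto (berezin S) toBoundary (𝓝 0) := by
  have hc : IsCompact (closure (S '' closedBall 0 1)) :=
    IsCompactOperator.isCompact_closure_image_closedBall
      (f := (S : bergmanSpace →ₗ[ℂ] bergmanSpace)) hS 1
  rw [Metric.tendsto_nhds]
  intro ε hε
  -- A finite net of the image of the unit ball reduces the claim to weak convergence against
  -- finitely many vectors.
  obtain ⟨t, -, htf, hcov⟩ := hc.finite_cover_balls (e := ε / 2) (by positivity)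
  have h1 : ∀ᶠ z in toBoundary, ∀ y ∈ t, ‖inner ℂ (normalizedKernel z) y‖ < ε / 2 := by
    rw [eventually_all_finite htf]
    intro y _
    simpa using Metric.tendsto_nhds.1 (tendsto_inner_normalizedKernel y) (ε / 2) (by positivity)
  filter_upwards [h1] with z hz
  have hmem : S (normalizedKernel z) ∈ closure (S '' closedBall 0 1) :=
    subset_closure ⟨_, by rw [mem_closedBall_zero_iff, norm_normalizedKernel], rfl⟩
  obtain ⟨y, hy, hyz⟩ := mem_iUnion₂.1 (hcov hmem)
  rw [mem_ball, dist_eq_norm] at hyz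
  have h2 := norm_inner_le_norm (𝕜 := ℂ) (normalizedKernel z) (S (normalizedKernel z) - y)
  rw [norm_normalizedKernel, one_mul] at h2
  have h3 : berezin S z = inner ℂ (normalizedKernel z) (S (normalizedKernel z) - y) +
      inner ℂ (normalizedKernel z) y := by
    rw [← inner_add_right (𝕜 := ℂ) (E := bergmanSpace), sub_add_cancel, berezin]
  rw [dist_zero_right, h3]
  linarith [norm_add_le (inner ℂ (normalizedKernel z) (S (normalizedKernel z) - y))
    (inner ℂ (normalizedKernel z) y), hz y hy]

/-! ### Compactness from boundary decay of the Berezin transform -/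

lemma exists_forall_lt_norm_of_eventually {p : 𝔻 → Prop} (h : ∀ᶠ z in toBoundary, p z) :
    ∃ r < 1, ∀ z : 𝔻, r < ‖(z : ℂ)‖ → p z := by
  rw [toBoundary, eventually_comap] at h
  obtain ⟨δ, hδ, h⟩ := Metric.eventually_nhds_iff.1 h
  refine ⟨1 - δ, by linarith, fun z hz => h ?_ z rfl⟩
  rw [Real.dist_eq, abs_lt]
  constructor <;> linarith [z.norm_lt_one]

/-- If the Berezin transform of the symbol vanishes at the boundary, the Toeplitz operator is
compact. -/
lemma isCompactOperator_toeplitz {u : Lp ℂ ∞ diskMeasure}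
    (h : Tendsto (berezinSymbol u) toBoundary (𝓝 0)) : IsCompactOperator (toeplitz u) := by
  obtain ⟨v, hv, ⟨M, -, hM⟩, huv⟩ := exists_bounded_representative u
  obtain ⟨A, hAt, hA⟩ := exists_lintegral_toeplitzKernel_right_le hv hM
  obtain ⟨C, hCt, hC⟩ := exists_lintegral_toeplitzKernel_mul_schurWeight_le
  have hlim : Tendsto (fun z : 𝔻 => C * translateNorm v z) toBoundary (𝓝 0) := by
    simpa using ENNReal.Tendsto.const_mul (a := C) (tendsto_translateNorm huv hv hM h) (Or.inr hCt)
  refine isCompactOperator_of_forall_norm_sub_le fun ε hε => ?_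
  -- The Schur test bounds the squared norm by the product of the row and column constants, so this
  -- column constant makes it at most ε².
  have hδ : 0 < ENNReal.ofReal (ε ^ 2) / (A + 1) :=
    ENNReal.div_pos (ENNReal.ofReal_pos.2 (by positivity)).ne' (by finiteness)
  obtain ⟨r, hr, hrz⟩ := exists_forall_lt_norm_of_eventually (hlim.eventually_le_const hδ)
  refine ⟨toeplitz u ∘L cutoff r, (isCompactOperator_cutoff hr).clm_comp (toeplitz u), ?_⟩
  refine ContinuousLinearMap.opNorm_le_bound _ hε.le fun f => ?_
  rw [sub_apply, ContinuousLinearMap.comp_apply, ← map_sub]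
  have key := enorm_toeplitz_sub_cutoff_sq_le huv hv (r := r)
    (B := ENNReal.ofReal (ε ^ 2) / (A + 1)) hA (fun z hz hrz' => (hC v hv z hz).trans
      (mul_le_mul_left (hrz (Complex.UnitDisc.mk z hz) hrz') _)) f
  have hAB : A * (ENNReal.ofReal (ε ^ 2) / (A + 1)) ≤ ENNReal.ofReal (ε ^ 2) :=
    (mul_le_mul_left le_self_add _).trans ENNReal.mul_div_le
  have key2 := key.trans (mul_le_mul_left hAB _)
  rw [← ofReal_norm, ← ofReal_norm, ← ENNReal.ofReal_pow (norm_nonneg _),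
    ← ENNReal.ofReal_pow (norm_nonneg _), ← ENNReal.ofReal_mul (by positivity), ← mul_pow,
    ENNReal.ofReal_le_ofReal_iff (by positivity)] at key2
  exact (pow_le_pow_iff_left₀ (norm_nonneg _) (by positivity) two_ne_zero).1 key2

end

theorem mainTheorem2 (u : Lp ℂ ∞ diskMeasure) :
    IsCompactOperator (toeplitz u) ↔ Tendsto (berezinSymbol u) toBoundary (𝓝 0) := by
  exact ⟨fun h => h.tendsto_berezin, isCompactOperator_toeplitz⟩
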